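/- For rational numbers $a,b$ and a prime $p$, write $a\equiv b \pmod p$ if the denominators of $a$ and $b$ (in lowest terms) are not divisible by $p$ and $p$ divides the numerator of $a-b$; $[\cdot]$ denotes the integer part. Let $p>5$ be a prime and let $\varepsilon_p=1,-1,0$ according as $p\equiv\pm1,\ \pm2,\ \pm4\pmod 9$. (i) If $p\equiv 1,4\pmod{15}$, then there are integers $x,y$ with $p=x^2+15y^2$, and for all such $x,y$ $$2\sum_{k=0}^{[p/6]}\frac{\binom{6k}{2k}}{27^{2k}}-\varepsilon_p\equiv\sum_{k=0}^{[p/3]}\frac{\binom{3k}{k}}{(-27)^k}\equiv\begin{cases}1\pmod p&\text{if }3\mid y,\\ \dfrac{x-5y}{10y}\pmod p&\text{if }3\mid y-x.\end{cases}$$ (ii) If $p\equiv 2,8\pmod{15}$, then there are integers $x,y$ with $p=5x^2+3y^2$, and for all such $x,y$ $$2\sum_{k=0}^{[p/6]}\frac{\binom{6k}{2k}}{27^{2k}}-\varepsilon_p\equiv\sum_{k=0}^{[p/3]}\frac{\binom{3k}{k}}{(-27)^k}\equiv\begin{cases}1\pmod p&\text{if }3\mid y,\\ -\dfrac{x+y}{2y}\pmod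 p&\text{if }3\mid y-x.\end{cases}$$ -/

import Mathlib

/-- Congruence modulo `p` of rational numbers: both sides are `p`-integral (their reduced
denominators are not divisible by `p`), and `p` divides the reduced numerator of the difference. -/
def RatModEq (p : ℕ) (a b : ℚ) : Prop :=
  ¬ p ∣ a.den ∧ ¬ p ∣ b.den ∧ (p : ℤ) ∣ (a - b).num

/-- `ε_p = 1, -1, 0` according as `p ≡ ±1, ±2, ±4 (mod 9)`. -/
def epsNine (p : ℕ) : ℚ :=
  if p % 9 = 1 ∨ p % 9 = 8 then 1 else if p % 9 = 2 ∨ p % 9 = 7 then -1 else 0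

/-- The sum of `C(3k, k) / (-27)^k` over `0 ≤ k ≤ ⌊p/3⌋`. -/
def cubicSum (p : ℕ) : ℚ :=
  ∑ k ∈ Finset.range (p / 3 + 1), ((3 * k).choose k : ℚ) / (-27) ^ k

/-- The sum of `C(6k, 2k) / 27^(2k)` over `0 ≤ k ≤ ⌊p/6⌋`. -/
def sexticSum (p : ℕ) : ℚ :=
  ∑ k ∈ Finset.range (p / 6 + 1), ((6 * k).choose (2 * k) : ℚ) / 27 ^ (2 * k)

/-! Put `n = p / 3`. Since `p` is `3n + 1` or `3n + 2`, the ratios of consecutive terms give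
`C(3k,k) ≡ C(n+k,2k) (-27)^k` mod `p`. So dividing by `(-27)^k` or by `27^k` turns the sums into `∑
C(n+k,2k) t^k` at `t = 1` or `t = -1`. At `t = -1` this is periodic in `n` and equals `ε_p`; adding
the two sums kills the odd terms and doubles the even ones, which links the sextic sum to the cubic
one.

At `t = 1` it is the Fibonacci number `(u^(2n+1) - v^(2n+1)) / (u - v)`, with `u, v = (1 ± √5)/2`.
Write `θ = √-3`. In characteristic `p` the representation of `p` supplies `√5` as `x/(yθ)` or
`yθ/x`, so `u/v` is, up to sign, `(x + yθ)/(x - yθ)`. If `u` and `v` raised to `(p^2-1)/3` differ by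
the factor `ψ`, `ψ^3 = 1`, then Frobenius and `uv = -1` turn the Fibonacci quotient into `(ψ^2 u - ψ
v)/√5`.

Finding `ψ` is a matter of rational cubic reciprocity in `ℤ[ω]`. For `a` an associate of `x + yθ`
with `3 ∣ a.im`, the symbol modulo `a` is assembled from cubic characters modulo the primes `q ∣
N(a)`, peeling Jacobi sums off `a` (`exists_isCubicSymbol`); its reciprocity law comes from
Frobenius acting on Gauss sums (`map_jacobiSum_pow`). As `p ≡ ±3(2y)^2` modulo `N(a) = x^2 + 3y^2`,
only the symbols of 3 and of a coordinate of `a` are needed (`map_re`, `map_three_and_map_im`). They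
give `ψ = 1` when `3 ∣ y`, and otherwise `ψ = ω^2` or `ω` according to the form.

Existence of `x, y` is reduction of binary quadratic forms of determinant 15. -/

/-! ### Truncated sums modulo a prime -/

/-- The sum `∑ k ≤ n, C(n + k, 2k) t ^ k`. -/
def morganVoyce {R : Type*} [CommRing R] (t : R) (n : ℕ) : R :=
  ∑ k ∈ Finset.range (n + 1), ((n + k).choose (2 * k) : R) * t ^ k

/-- Three uses of Pascal's rule. This is the coefficientwise form of the recurrence in
`morganVoyce_add_two`. -/
lemma choose_second_difference (n k : ℕ) :
    (n + 2 + (k + 1)).choose (2 * (k + 1)) + (n + (k + 1)).choose (2 * (k + 1)) =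
      2 * (n + 1 + (k + 1)).choose (2 * (k + 1)) + (n + 1 + k).choose (2 * k) := by
  have e1 : (n + 2 + (k + 1)).choose (2 * (k + 1)) = (n + k + 2).choose (2 * k + 1)
      + (n + k + 2).choose (2 * k + 2) := by
    rw [show n + 2 + (k + 1) = (n + k + 2) + 1 by ring, show 2 * (k + 1) = (2 * k + 1) + 1 by ring,
      Nat.choose_succ_succ]
  have e2 : (n + k + 2).choose (2 * k + 1) = (n + k + 1).choose (2 * k)
      + (n + k + 1).choose (2 * k + 1) := Nat.choose_succ_succ _ _
  have e3 : (n + k + 2).choose (2 * k + 2) = (n + k + 1).choose (2 * k + 1)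
      + (n + k + 1).choose (2 * k + 2) := Nat.choose_succ_succ _ _
  have e4 : n + (k + 1) = n + k + 1 := by ring
  have e5 : n + 1 + (k + 1) = n + k + 2 := by ring
  have e6 : n + 1 + k = n + k + 1 := by ring
  have e7 : 2 * (k + 1) = 2 * k + 2 := by ring
  rw [e1, e4, e5, e6, e7]
  omega

lemma morganVoyce_eq_of_le {R : Type*} [CommRing R] (t : R) {n m : ℕ} (h : n ≤ m) :
    morganVoyce t n = ∑ k ∈ Finset.range (m + 1), ((n + k).choose (2 * k) : R) * t ^ k := by
  unfold morganVoyce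
  refine Finset.sum_subset (Finset.range_mono (by omega)) fun k _ hk ↦ ?_
  rw [Finset.mem_range, not_lt] at hk
  rw [Nat.choose_eq_zero_of_lt (by omega)]
  simp

lemma morganVoyce_add_two {R : Type*} [CommRing R] (t : R) (n : ℕ) :
    morganVoyce t (n + 2) = (2 + t) * morganVoyce t (n + 1) - morganVoyce t n := by
  have h0 := morganVoyce_eq_of_le t (show n + 2 ≤ n + 2 from le_rfl)
  have h1 := morganVoyce_eq_of_le t (show n + 1 ≤ n + 2 by omega)
  have h2 := morganVoyce_eq_of_le t (show n ≤ n + 2 by omega)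
  have h3 := morganVoyce_eq_of_le t (show n + 1 ≤ n + 1 from le_rfl)
  rw [Finset.sum_range_succ'] at h0 h1 h2
  have key : ∑ k ∈ Finset.range (n + 2), ((n + 2 + (k + 1)).choose (2 * (k + 1)) : R) * t ^ (k + 1)
      + ∑ k ∈ Finset.range (n + 2), ((n + (k + 1)).choose (2 * (k + 1)) : R) * t ^ (k + 1)
      = 2 * ∑ k ∈ Finset.range (n + 2), ((n + 1 + (k + 1)).choose (2 * (k + 1)) : R) * t ^ (k + 1)
      + t * ∑ k ∈ Finset.range (n + 2), ((n + 1 + k).choose (2 * k) : R) * t ^ k := by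
    rw [Finset.mul_sum, Finset.mul_sum, ← Finset.sum_add_distrib, ← Finset.sum_add_distrib]
    refine Finset.sum_congr rfl fun k _ ↦ ?_
    have := congrArg (Nat.cast : ℕ → R) (choose_second_difference n k)
    push_cast at this
    linear_combination t ^ (k + 1) * this
  rw [← h3] at key
  simp only [mul_zero, add_zero, Nat.choose_zero_right, Nat.cast_one, pow_zero, mul_one] at h0 h1 h2
  linear_combination h0 + h2 - 2 * h1 + key

lemma morganVoyce_zero {R : Type*} [CommRing R] (t : R) : morganVoyce t 0 = 1 := by
  simp [morganVoyce]

lemma morganVoyce_one {R : Type*} [CommRing R] (t : R) : morganVoyce t 1 = 1 + t := by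
  simp [morganVoyce, Finset.sum_range_succ]

/-- Binet's formula for odd-indexed Fibonacci numbers: the recurrence at `t = 1` has characteristic
roots `u ^ 2` and `v ^ 2`. -/
lemma morganVoyce_one_mul_sub {R : Type*} [CommRing R] {u v : R} (h : u + v = 1) (h' : u * v = -1)
    (n : ℕ) : morganVoyce (1 : R) n * (u - v) = u ^ (2 * n + 1) - v ^ (2 * n + 1) := by
  have hu : u ^ 2 = u + 1 := by linear_combination u * h - h'
  have hv : v ^ 2 = v + 1 := by linear_combination v * h - h'
  induction n using Nat.twoStepInduction with
  | zero => simp [morganVoyce_zero]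
  | one =>
    rw [morganVoyce_one]
    linear_combination (-u - 1) * hu + (v + 1) * hv
  | more n h1 h2 =>
    rw [morganVoyce_add_two]
    have e1 : u ^ 4 = 3 * u ^ 2 - 1 := by linear_combination (u ^ 2 + u - 1) * hu
    have e2 : v ^ 4 = 3 * v ^ 2 - 1 := by linear_combination (v ^ 2 + v - 1) * hv
    linear_combination 3 * h2 - h1 - u ^ (2 * n + 1) * e1 + v ^ (2 * n + 1) * e2

lemma morganVoyce_neg_one_add_three {R : Type*} [CommRing R] (n : ℕ) :
    morganVoyce (-1 : R) (n + 3) = -morganVoyce (-1 : R) n := by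
  have h1 := morganVoyce_add_two (-1 : R) n
  have h2 := morganVoyce_add_two (-1 : R) (n + 1)
  rw [show n + 3 = n + 1 + 2 from rfl, h2, show n + 1 + 1 = n + 2 from rfl, h1]
  ring

lemma morganVoyce_neg_one_add_six {R : Type*} [CommRing R] (m i : ℕ) :
    morganVoyce (-1 : R) (6 * m + i) = morganVoyce (-1 : R) i := by
  induction m with
  | zero => simp
  | succ m ih =>
    rw [show 6 * (m + 1) + i = 6 * m + i + 3 + 3 by ring, morganVoyce_neg_one_add_three,
      morganVoyce_neg_one_add_three, ih, neg_neg]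

lemma morganVoyce_neg_one_div_three {S : Type*} [CommRing S] {p : ℕ}
    (hp : p.Prime) (hp5 : 5 < p) :
    morganVoyce (-1 : S) (p / 3) =
      if p % 9 = 1 ∨ p % 9 = 8 then 1 else if p % 9 = 2 ∨ p % 9 = 7 then -1 else 0 := by
  have h2 : p % 2 = 1 := (hp.eq_two_or_odd).resolve_left (by omega)
  have h3 : p % 3 ≠ 0 := fun h ↦ by
    have := (Nat.prime_dvd_prime_iff_eq Nat.prime_three hp).1 (Nat.dvd_of_mod_eq_zero h)
    omega
  have v2 : morganVoyce (-1 : S) 2 = -1 := by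
    rw [morganVoyce_add_two, morganVoyce_one, morganVoyce_zero]; ring
  have v3 : morganVoyce (-1 : S) 3 = -1 := by
    rw [morganVoyce_neg_one_add_three, morganVoyce_zero]
  have v4 : morganVoyce (-1 : S) 4 = 0 := by
    rw [morganVoyce_neg_one_add_three, morganVoyce_one]; ring
  have v5 : morganVoyce (-1 : S) 5 = 1 := by
    rw [morganVoyce_neg_one_add_three, v2]; ring
  have hn : p / 3 = 6 * (p / 18) + (p % 18) / 3 := by omega
  rw [hn, morganVoyce_neg_one_add_six]
  have h18 : p % 18 = 1 ∨ p % 18 = 5 ∨ p % 18 = 7 ∨ p % 18 = 11 ∨ p % 18 = 13 ∨ p % 18 = 17 := by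
    omega
  have h9 : p % 9 = p % 18 % 9 := by omega
  rcases h18 with h | h | h | h | h | h <;> rw [h9, h] <;>
    simp [v2, v3, v4, v5, morganVoyce_one, morganVoyce_zero]

lemma choose_three_mul_succ (k : ℕ) :
    (3 * (k + 1)).choose (k + 1) * ((2 * k + 1) * (2 * k + 2)) =
      3 * (3 * k).choose k * ((3 * k + 1) * (3 * k + 2)) := by
  have h1 := Nat.choose_mul_factorial_mul_factorial (show k ≤ 3 * k by omega)
  have h2 := Nat.choose_mul_factorial_mul_factorial (show k + 1 ≤ 3 * (k + 1) by omega)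
  rw [show 3 * k - k = 2 * k by omega] at h1
  rw [show 3 * (k + 1) - (k + 1) = 2 * k + 1 + 1 by omega, show 3 * (k + 1) = 3 * k + 2 + 1 by ring,
    Nat.factorial_succ (2 * k + 1), Nat.factorial_succ (2 * k), Nat.factorial_succ (3 * k + 2),
    Nat.factorial_succ (3 * k + 1), Nat.factorial_succ (3 * k), Nat.factorial_succ k, ← h1] at h2
  have h0 : 0 < (k + 1) * (k.factorial * (2 * k).factorial) := by positivity
  refine Nat.eq_of_mul_eq_mul_right h0 ?_
  rw [show 3 * (k + 1) = 3 * k + 2 + 1 by ring]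
  linear_combination h2

lemma choose_add_two_mul_succ (n k : ℕ) :
    (n + (k + 1)).choose (2 * (k + 1)) * ((2 * k + 1) * (2 * k + 2)) =
      (n + k).choose (2 * k) * ((n + k + 1) * (n - k)) := by
  have h1 := Nat.add_one_mul_choose_eq (n + k) (2 * k + 1)
  have h2 := Nat.choose_succ_right_eq (n + k) (2 * k)
  rw [show n + k - 2 * k = n - k by omega] at h2
  rw [show n + (k + 1) = n + k + 1 by ring, show 2 * (k + 1) = 2 * k + 1 + 1 by ring]
  calc _ = (n + k + 1).choose (2 * k + 1 + 1) * (2 * k + 1 + 1) * (2 * k + 1) := by ring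
    _ = (n + k + 1) * ((n + k).choose (2 * k + 1) * (2 * k + 1)) := by rw [← h1]; ring
    _ = _ := by rw [h2]; ring

/-- With `n = p / 3`, `(3n+1)(3n+2) = 0` yields `9(n+k+1)(n-k) = -(3k+1)(3k+2)`, so both sides have
the same ratio of consecutive terms. -/
lemma choose_three_mul_eq {p : ℕ} [Fact p.Prime] (hp3 : p ≠ 3) {k : ℕ} (hk : k ≤ p / 3) :
    ((3 * k).choose k : ZMod p) = ((p / 3 + k).choose (2 * k) : ZMod p) * (-27) ^ k := by
  have hp := Fact.out (p := p.Prime)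
  have h3 : p % 3 ≠ 0 := fun h ↦
    hp3 ((Nat.prime_dvd_prime_iff_eq Nat.prime_three hp).1 (Nat.dvd_of_mod_eq_zero h)).symm
  have hn : (3 * (p / 3 : ℕ) + 1 : ZMod p) * (3 * (p / 3 : ℕ) + 2) = 0 := by
    have hp0 : (p : ZMod p) = 0 := ZMod.natCast_self p
    rcases (by omega : 3 * (p / 3) + 1 = p ∨ 3 * (p / 3) + 2 = p) with h | h
    · have := (congrArg (Nat.cast : ℕ → ZMod p) h).trans hp0
      push_cast at this
      rw [this, zero_mul]
    · have := (congrArg (Nat.cast : ℕ → ZMod p) h).trans hp0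
      push_cast at this
      rw [this, mul_zero]
  induction k with
  | zero => simp
  | succ k ih =>
    have ih := ih (by omega)
    -- Both factors are positive and below `p`, because `k + 1 ≤ p / 3`.
    have hne : ((2 * k + 1 : ℕ) * (2 * k + 2 : ℕ) : ZMod p) ≠ 0 := by
      refine mul_ne_zero ?_ ?_ <;> rw [Ne, ZMod.natCast_eq_zero_iff] <;> intro h <;>
        have := Nat.le_of_dvd (by omega) h <;> omega
    have h1 := congrArg (Nat.cast : ℕ → ZMod p) (choose_three_mul_succ k)
    have h2 := congrArg (Nat.cast : ℕ → ZMod p) (choose_add_two_mul_succ (p / 3) k)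
    push_cast [Nat.cast_sub (show k ≤ p / 3 by omega)] at h1 h2 hne
    refine mul_right_cancel₀ hne ?_
    rw [h1, ih]
    generalize ((p / 3 : ℕ) : ZMod p) = n at h2 hn
    linear_combination 3 * ((p / 3 + k).choose (2 * k) : ZMod p) * (-27) ^ k * hn
      - (-27) ^ (k + 1) * h2

/-! ### Reduction of rational numbers modulo a prime -/

/-- The rational number `r` is `p`-integral and reduces to `z` modulo `p`. -/
def ReducesTo (p : ℕ) (r : ℚ) (z : ZMod p) : Prop :=
  ∃ n d : ℤ, (d : ZMod p) ≠ 0 ∧ r * d = n ∧ (n : ZMod p) = z * d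

section ReducesTo

variable {p : ℕ} [Fact p.Prime] {r s : ℚ} {z w : ZMod p}

lemma ReducesTo.intCast (m : ℤ) : ReducesTo p m m := ⟨m, 1, by simp, by simp, by simp⟩

lemma ReducesTo.add (h : ReducesTo p r z) (h' : ReducesTo p s w) : ReducesTo p (r + s) (z + w) := by
  obtain ⟨n, d, hd, hr, hz⟩ := h
  obtain ⟨m, e, he, hs, hw⟩ := h'
  refine ⟨n * e + m * d, d * e, by push_cast; exact mul_ne_zero hd he, ?_, ?_⟩
  · push_cast
    linear_combination (e : ℚ) * hr + (d : ℚ) * hs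
  · push_cast
    linear_combination (e : ZMod p) * hz + (d : ZMod p) * hw

lemma ReducesTo.mul (h : ReducesTo p r z) (h' : ReducesTo p s w) : ReducesTo p (r * s) (z * w) := by
  obtain ⟨n, d, hd, hr, hz⟩ := h
  obtain ⟨m, e, he, hs, hw⟩ := h'
  refine ⟨n * m, d * e, by push_cast; exact mul_ne_zero hd he, ?_, ?_⟩
  · push_cast
    linear_combination s * e * hr + (n : ℚ) * hs
  · push_cast
    linear_combination w * e * hz + (n : ZMod p) * hw

lemma ReducesTo.div_intCast {m : ℤ} (hm : (m : ZMod p) ≠ 0) (h : ReducesTo p r z) :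
    ReducesTo p (r / m) (z / m) := by
  obtain ⟨n, d, hd, hr, hz⟩ := h
  have hm' : (m : ℚ) ≠ 0 := by rintro h; rw [Int.cast_eq_zero] at h; simp [h] at hm
  refine ⟨n, d * m, by push_cast; exact mul_ne_zero hd hm, ?_, ?_⟩
  · push_cast
    rw [← hr]
    field_simp
  · push_cast
    rw [hz]
    field_simp

lemma ReducesTo.sum {ι : Type*} {t : Finset ι} {f : ι → ℚ} {g : ι → ZMod p}
    (h : ∀ i ∈ t, ReducesTo p (f i) (g i)) : ReducesTo p (∑ i ∈ t, f i) (∑ i ∈ t, g i) := by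
  classical
  induction t using Finset.induction_on with
  | empty => simpa using ReducesTo.intCast (p := p) 0
  | insert a t ha ih =>
    rw [Finset.sum_insert ha, Finset.sum_insert ha]
    exact (h a (by simp)).add (ih fun i hi ↦ h i (by simp [hi]))

/-- The reduced denominator divides every denominator of `r`, so one denominator prime to `p` is
enough. -/
lemma ReducesTo.not_dvd_den (h : ReducesTo p r z) : ¬p ∣ r.den := by
  obtain ⟨n, d, hd, hr, -⟩ := h
  intro hp
  have hd0 : (d : ℚ) ≠ 0 := by rintro h; rw [Int.cast_eq_zero] at h; simp [h] at hd
  have : (r.den : ℤ) ∣ d := by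
    rw [eq_div_of_mul_eq hd0 hr, ← Rat.divInt_eq_div]
    exact Rat.den_dvd n d
  exact hd ((ZMod.intCast_zmod_eq_zero_iff_dvd d p).2 ((Int.natCast_dvd_natCast.2 hp).trans this))

lemma ReducesTo.num_eq (h : ReducesTo p r z) : (r.num : ZMod p) = z * r.den := by
  obtain ⟨n, d, hd, hr, hz⟩ := h
  have h1 : r.num * d = n * r.den := by
    have : (r.den : ℚ) ≠ 0 := by simp
    have h2 : (r.num : ℚ) = r * r.den := (Rat.mul_den_eq_num r).symm
    have h3 : (r.num : ℚ) * d = n * r.den := by rw [h2, ← hr]; ring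
    exact_mod_cast h3
  have h2 := congrArg (Int.cast : ℤ → ZMod p) h1
  push_cast at h2
  exact mul_right_cancel₀ hd (by rw [h2, hz]; ring)

lemma ReducesTo.ratModEq (h : ReducesTo p r z) (h' : ReducesTo p s z) : RatModEq p r s := by
  refine ⟨h.not_dvd_den, h'.not_dvd_den, ?_⟩
  have h1 := (h.add ((ReducesTo.intCast (-1)).mul h')).num_eq
  rw [← ZMod.intCast_zmod_eq_zero_iff_dvd]
  rw [show r - s = r + ((-1 : ℤ) : ℚ) * s by push_cast; ring, h1]
  push_cast
  ring

end ReducesTo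

/-! ### The cubic and sextic sums modulo `p` -/

section Sums

variable {p : ℕ} [Fact p.Prime]

lemma reducesTo_choose_div (hp3 : p ≠ 3) {k : ℕ} (hk : k ≤ p / 3) {c : ℤ} (hc : c = 27 ∨ c = -27) :
    ReducesTo p (((3 * k).choose k : ℚ) / c ^ k)
      (((p / 3 + k).choose (2 * k) : ZMod p) * (-27 / c) ^ k) := by
  have hp := Fact.out (p := p.Prime)
  have h27 : (27 : ZMod p) ≠ 0 := by
    rw [show (27 : ZMod p) = 3 ^ 3 by norm_num]
    refine pow_ne_zero _ fun h ↦ hp3 ?_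
    rw [show (3 : ZMod p) = (3 : ℕ) by norm_num, ZMod.natCast_eq_zero_iff] at h
    exact (Nat.prime_dvd_prime_iff_eq hp Nat.prime_three).1 h
  have hc0 : (c : ZMod p) ≠ 0 := by rcases hc with rfl | rfl <;> push_cast <;> simpa using h27
  have h := (ReducesTo.intCast (p := p) ((3 * k).choose k : ℤ)).div_intCast (m := c ^ k)
    (by push_cast; exact pow_ne_zero _ hc0)
  push_cast at h
  rwa [choose_three_mul_eq hp3 hk, mul_div_assoc, ← div_pow] at h

lemma cubicSum_reducesTo (hp3 : p ≠ 3) : ReducesTo p (cubicSum p) (morganVoyce 1 (p / 3)) := by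
  refine ReducesTo.sum fun k hk ↦ ?_
  have hk' : k ≤ p / 3 := by simpa [Nat.lt_succ_iff] using hk
  have h := reducesTo_choose_div hp3 hk' (c := -27) (by simp)
  have h27 : (27 : ZMod p) ≠ 0 := by
    rw [show (27 : ZMod p) = 3 ^ 3 by norm_num]
    refine pow_ne_zero _ fun h ↦ hp3 ?_
    rw [show (3 : ZMod p) = (3 : ℕ) by norm_num, ZMod.natCast_eq_zero_iff] at h
    exact (Nat.prime_dvd_prime_iff_eq Fact.out Nat.prime_three).1 h
  push_cast at h
  rwa [div_self (by simpa using h27)] at h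

lemma two_mul_sexticSum (p : ℕ) : 2 * sexticSum p = cubicSum p +
    ∑ k ∈ Finset.range (p / 3 + 1), ((3 * k).choose k : ℚ) / 27 ^ k := by
  unfold sexticSum cubicSum
  have h : ∀ k : ℕ, ((3 * k).choose k : ℚ) / (-27) ^ k + ((3 * k).choose k : ℚ) / 27 ^ k =
      if Even k then 2 * (((3 * k).choose k : ℚ) / 27 ^ k) else 0 := by
    intro k
    split_ifs with hk
    · rw [hk.neg_pow]; ring
    · rw [(Nat.not_even_iff_odd.1 hk).neg_pow, div_neg]; ring
  rw [← Finset.sum_add_distrib, Finset.sum_congr rfl fun k _ ↦ h k, ← Finset.sum_filter,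
    Finset.mul_sum]
  refine Finset.sum_nbij' (fun k ↦ 2 * k) (fun k ↦ k / 2) ?_ ?_ ?_ ?_ ?_
  · intro k hk
    simp only [Finset.mem_filter, Finset.mem_range] at hk ⊢
    exact ⟨by omega, even_two_mul k⟩
  · intro k hk
    simp only [Finset.mem_filter, Finset.mem_range] at hk ⊢
    omega
  · intro k _
    simp
  · intro k hk
    simp only [Finset.mem_filter, Finset.mem_range] at hk
    exact Nat.mul_div_cancel' hk.2.two_dvd
  · intro k _
    rw [show 3 * (2 * k) = 6 * k by ring]

lemma sexticSum_reducesTo (hp5 : 5 < p) :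
    ReducesTo p (2 * sexticSum p - epsNine p) (morganVoyce 1 (p / 3)) := by
  have hp3 : p ≠ 3 := by omega
  have h27 : (27 : ZMod p) ≠ 0 := by
    rw [show (27 : ZMod p) = 3 ^ 3 by norm_num]
    refine pow_ne_zero _ fun h ↦ hp3 ?_
    rw [show (3 : ZMod p) = (3 : ℕ) by norm_num, ZMod.natCast_eq_zero_iff] at h
    exact (Nat.prime_dvd_prime_iff_eq Fact.out Nat.prime_three).1 h
  have h1 : ReducesTo p (∑ k ∈ Finset.range (p / 3 + 1), ((3 * k).choose k : ℚ) / 27 ^ k)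
      (morganVoyce (-1) (p / 3)) := by
    refine ReducesTo.sum fun k hk ↦ ?_
    have hk' : k ≤ p / 3 := by simpa [Nat.lt_succ_iff] using hk
    have h := reducesTo_choose_div hp3 hk' (c := 27) (by simp)
    push_cast at h
    rwa [neg_div, div_self h27] at h
  have h2 : ReducesTo p (epsNine p) (morganVoyce (-1) (p / 3)) := by
    rw [morganVoyce_neg_one_div_three Fact.out hp5, epsNine]
    split_ifs
    · simpa using ReducesTo.intCast (p := p) 1
    · simpa using ReducesTo.intCast (p := p) (-1)
    · simpa using ReducesTo.intCast (p := p) 0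
  have h3 := ((cubicSum_reducesTo hp3).add h1).add ((ReducesTo.intCast (-1)).mul h2)
  rw [← two_mul_sexticSum] at h3
  convert h3 using 1
  · push_cast; ring
  · push_cast; ring

end Sums

/-! ### Representation by forms of discriminant `-60` -/

/-- Gauss reduction by induction on the leading coefficient. The reduced forms of determinant 15 are
`x^2 + 15y^2`, `3x^2 + 5y^2`, and forms `(2, ±1, 8)`, `(4, ±1, 4)` taking only even values. -/
lemma exists_rep_of_form (k : ℕ) : ∀ A B C : ℤ, A.natAbs = k → 0 < A → A * C - B ^ 2 = 15 →
    ∀ u v : ℤ, ∃ x y : ℤ, A * u ^ 2 + 2 * B * u * v + C * v ^ 2 = x ^ 2 + 15 * y ^ 2 ∨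
      A * u ^ 2 + 2 * B * u * v + C * v ^ 2 = 5 * x ^ 2 + 3 * y ^ 2 ∨
      A * u ^ 2 + 2 * B * u * v + C * v ^ 2 = 2 * x := by
  induction k using Nat.strong_induction_on with
  | _ k ih =>
  intro A B C hk hA hdisc u v
  obtain ⟨t, hB1, hB2⟩ : ∃ t : ℤ, 2 * (B - t * A) ≤ A ∧ -A ≤ 2 * (B - t * A) := by
    refine ⟨(2 * B + A) / (2 * A), ?_, ?_⟩ <;>
    · have h1 := Int.emod_add_mul_ediv (2 * B + A) (2 * A)
      have h2 := Int.emod_nonneg (2 * B + A) (show 2 * A ≠ 0 by omega)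
      have h3 := Int.emod_lt_of_pos (2 * B + A) (show 0 < 2 * A by omega)
      linarith
  set b := B - t * A with hb
  set c := C - 2 * t * B + t ^ 2 * A with hc
  have hd : A * c - b ^ 2 = 15 := by rw [hb, hc]; linear_combination hdisc
  have hval : A * u ^ 2 + 2 * B * u * v + C * v ^ 2 =
      A * (u + t * v) ^ 2 + 2 * b * (u + t * v) * v + c * v ^ 2 := by rw [hb, hc]; ring
  rw [hval]
  generalize u + t * v = u'
  have hc0 : 0 < c := by
    by_contra! h
    nlinarith [sq_nonneg b]
  rcases lt_or_ge c A with hlt | hge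
  · obtain ⟨x, y, h⟩ := ih c.natAbs (by omega) c b A rfl hc0 (by linarith) v u'
    refine ⟨x, y, ?_⟩
    rwa [show A * u' ^ 2 + 2 * b * u' * v + c * v ^ 2 = c * v ^ 2 + 2 * b * v * u' + A * u' ^ 2 by
      ring]
  -- `A^2 ≤ A c = 15 + b^2 ≤ 15 + A^2/4`.
  · have hA4 : A ≤ 4 := by
      by_contra! h
      nlinarith [mul_nonneg (sub_nonneg.2 hB1) (sub_nonneg.2 hB2)]
    have hb2 : b ≤ 2 := by omega
    have hb3 : -2 ≤ b := by omega
    clear_value b c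
    interval_cases A <;> interval_cases b <;> try omega
    · exact ⟨u', v, Or.inl (by rw [show c = 15 by omega]; ring)⟩
    · exact ⟨u' ^ 2 - u' * v + 4 * v ^ 2, 0, Or.inr (Or.inr (by rw [show c = 8 by omega]; ring))⟩
    · exact ⟨u' ^ 2 + u' * v + 4 * v ^ 2, 0, Or.inr (Or.inr (by rw [show c = 8 by omega]; ring))⟩
    · exact ⟨v, u', Or.inr (Or.inl (by rw [show c = 5 by omega]; ring))⟩
    · exact ⟨2 * u' ^ 2 - u' * v + 2 * v ^ 2, 0,
        Or.inr (Or.inr (by rw [show c = 4 by omega]; ring))⟩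
    · exact ⟨2 * u' ^ 2 + u' * v + 2 * v ^ 2, 0,
        Or.inr (Or.inr (by rw [show c = 4 by omega]; ring))⟩

lemma isSquare_neg_fifteen {p : ℕ} [Fact p.Prime] (hp5 : 5 < p)
    (h : p % 15 = 1 ∨ p % 15 = 4 ∨ p % 15 = 2 ∨ p % 15 = 8) : IsSquare ((-15 : ℤ) : ZMod p) := by
  have hp := Fact.out (p := p.Prime)
  have h2 : p % 2 = 1 := (hp.eq_two_or_odd).resolve_left (by omega)
  have h0 : ((-15 : ℤ) : ZMod p) ≠ 0 := by
    rw [Ne, ZMod.intCast_zmod_eq_zero_iff_dvd, dvd_neg]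
    intro h'
    have h'' : p ∣ 3 * 5 := by exact_mod_cast h'
    rcases hp.dvd_mul.1 h'' with h3 | h3 <;> have := Nat.le_of_dvd (by norm_num) h3 <;> omega
  rw [← legendreSym.eq_one_iff p h0, jacobiSym.legendreSym.to_jacobiSym,
    jacobiSym.mod_right _ (Nat.odd_iff.2 h2)]
  have : p % 60 = 1 ∨ p % 60 = 31 ∨ p % 60 = 19 ∨ p % 60 = 49 ∨ p % 60 = 17 ∨ p % 60 = 47 ∨
    p % 60 = 23 ∨ p % 60 = 53 := by omega
  rw [show 4 * (-15 : ℤ).natAbs = 60 from rfl]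
  rcases this with h | h | h | h | h | h | h | h <;> rw [h] <;> norm_num

lemma exists_rep {p : ℕ} [Fact p.Prime] (hp5 : 5 < p)
    (h : p % 15 = 1 ∨ p % 15 = 4 ∨ p % 15 = 2 ∨ p % 15 = 8) :
    ∃ x y : ℤ, (p : ℤ) = x ^ 2 + 15 * y ^ 2 ∨ (p : ℤ) = 5 * x ^ 2 + 3 * y ^ 2 := by
  have h2 : p % 2 = 1 := (Fact.out (p := p.Prime)).eq_two_or_odd.resolve_left (by omega)
  obtain ⟨s, hs⟩ := isSquare_neg_fifteen hp5 h
  obtain ⟨b, rfl⟩ := ZMod.intCast_surjective s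
  have : (p : ℤ) ∣ b ^ 2 + 15 := by
    rw [← ZMod.intCast_zmod_eq_zero_iff_dvd]
    push_cast at hs ⊢
    linear_combination -hs
  obtain ⟨c, hc⟩ := this
  -- The form `(p, b, c)` has determinant 15 and takes the value `p` at `(1, 0)`; the even
  -- alternative is excluded by parity.
  obtain ⟨x, y, hxy⟩ := exists_rep_of_form _ p b c rfl (by omega) (by linarith) 1 0
  rw [show (p : ℤ) * 1 ^ 2 + 2 * b * 1 * 0 + c * 0 ^ 2 = p by ring] at hxy
  rcases hxy with h | h | h
  · exact ⟨x, y, Or.inl h⟩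
  · exact ⟨x, y, Or.inr h⟩
  · omega

lemma exists_sq_add_fifteen_mul_sq {p : ℕ} [Fact p.Prime] (hp5 : 5 < p)
    (h : p % 15 = 1 ∨ p % 15 = 4) : ∃ x y : ℤ, (p : ℤ) = x ^ 2 + 15 * y ^ 2 := by
  obtain ⟨x, y, hxy | hxy⟩ := exists_rep hp5 (by omega)
  · exact ⟨x, y, hxy⟩
  · exfalso
    have h3 : (p : ℤ) % 3 = 1 := by omega
    have : x ^ 2 % 3 = 0 ∨ x ^ 2 % 3 = 1 := by
      rcases (by omega : x % 3 = 0 ∨ x % 3 = 1 ∨ x % 3 = 2) with h | h | h <;> simp [pow_two, Int.mul_emod, h]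
    omega

lemma exists_five_mul_sq_add_three_mul_sq {p : ℕ} [Fact p.Prime] (hp5 : 5 < p)
    (h : p % 15 = 2 ∨ p % 15 = 8) : ∃ x y : ℤ, (p : ℤ) = 5 * x ^ 2 + 3 * y ^ 2 := by
  obtain ⟨x, y, hxy | hxy⟩ := exists_rep hp5 (by omega)
  · exfalso
    have h3 : (p : ℤ) % 3 = 2 := by omega
    have : x ^ 2 % 3 = 0 ∨ x ^ 2 % 3 = 1 := by
      rcases (by omega : x % 3 = 0 ∨ x % 3 = 1 ∨ x % 3 = 2) with h | h | h <;> simp [pow_two, Int.mul_emod, h]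
    omega
  · exact ⟨x, y, hxy⟩

/-! ### Eisenstein integers -/

/-- The ring of Eisenstein integers `ℤ[ω]`, with `ω ^ 2 = -1 - ω`. -/
abbrev EisensteinInt : Type := QuadraticAlgebra ℤ (-1) (-1)

namespace EisensteinInt

open QuadraticAlgebra

/-- The primitive cube root of unity of `EisensteinInt`. -/
def w : EisensteinInt := ⟨0, 1⟩

lemma w_sq_add : w ^ 2 + w + 1 = 0 := by
  rw [pow_two]; ext <;> simp [w]

lemma w_pow_three : w ^ 3 = 1 := by linear_combination (w - 1) * w_sq_add

lemma eq_re_add_im (z : EisensteinInt) : z = z.re + z.im * w := by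
  ext <;> simp [w]

lemma star_w : star w = w ^ 2 := by
  rw [pow_two]; ext <;> simp [w]

lemma star_eq_re_add_im (z : EisensteinInt) : star z = z.re + z.im * w ^ 2 := by
  rw [pow_two]; ext <;> simp [w]

lemma norm_eq (z : EisensteinInt) : z.norm = z.re ^ 2 - z.re * z.im + z.im ^ 2 := by
  rw [norm_def]; ring

lemma norm_nonneg (z : EisensteinInt) : 0 ≤ z.norm := by
  rw [norm_eq]; nlinarith [sq_nonneg (z.re - z.im), sq_nonneg z.re, sq_nonneg z.im]

lemma norm_eq_zero {z : EisensteinInt} : z.norm = 0 ↔ z = 0 := by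
  refine ⟨fun h ↦ ?_, fun h ↦ by simp [h]⟩
  rw [norm_eq] at h
  have h1 : z.re ^ 2 = 0 := by
    nlinarith [sq_nonneg (z.re - 2 * z.im), sq_nonneg z.re]
  have h2 : z.im ^ 2 = 0 := by
    nlinarith [sq_nonneg (z.im - 2 * z.re), sq_nonneg z.im]
  ext
  · exact pow_eq_zero_iff two_ne_zero |>.1 h1
  · exact pow_eq_zero_iff two_ne_zero |>.1 h2

instance : NoZeroDivisors EisensteinInt where
  eq_zero_or_eq_zero_of_mul_eq_zero {a b} h := by
    have := congrArg QuadraticAlgebra.norm h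
    rw [map_mul, QuadraticAlgebra.norm_zero, mul_eq_zero, norm_eq_zero, norm_eq_zero] at this
    exact this

instance : IsDomain EisensteinInt := NoZeroDivisors.to_isDomain _

lemma mul_star_eq_norm (z : EisensteinInt) : z * star z = (z.norm : ℤ) := by
  rw [← algebraMap_norm_eq_mul_star]
  rfl

lemma w_ne_one : w ≠ 1 := fun h ↦ by simpa [w] using congrArg QuadraticAlgebra.im h

lemma isPrimitiveRoot_w : IsPrimitiveRoot w 3 :=
  IsPrimitiveRoot.iff_orderOf.2 (orderOf_eq_prime w_pow_three w_ne_one)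

lemma eq_of_pow_three_eq_one {z : EisensteinInt} (h : z ^ 3 = 1) : z = 1 ∨ z = w ∨ z = w ^ 2 := by
  have : (z - 1) * ((z - w) * (z - w ^ 2)) = 0 := by
    linear_combination h + (z - z ^ 2 ) * w_sq_add + (z - 1) * w_pow_three
  rcases mul_eq_zero.1 this with h | h
  · exact Or.inl (sub_eq_zero.1 h)
  · rcases mul_eq_zero.1 h with h | h
    · exact Or.inr (Or.inl (sub_eq_zero.1 h))
    · exact Or.inr (Or.inr (sub_eq_zero.1 h))

lemma star_eq_sq_of_pow_three_eq_one {z : EisensteinInt} (h : z ^ 3 = 1) : star z = z ^ 2 := by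
  rcases eq_of_pow_three_eq_one h with rfl | rfl | rfl
  · simp
  · exact star_w
  · rw [star_pow, star_w]

/-- The ring homomorphism from `EisensteinInt` sending `w` to `m`. -/
def liftHom {S : Type*} [CommRing S] (m : S) (hm : m ^ 2 + m + 1 = 0) : EisensteinInt →+* S where
  toFun z := z.re + z.im * m
  map_one' := by simp
  map_zero' := by simp
  map_add' a b := by simp; ring
  map_mul' a b := by
    simp only [re_mul, im_mul]
    push_cast
    linear_combination -(a.im : S) * b.im * hm

@[simp] lemma liftHom_w {S : Type*} [CommRing S] (m : S) (hm : m ^ 2 + m + 1 = 0) :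
    liftHom m hm w = m := by
  simp [liftHom, w]

/-! ### Images of Eisenstein integers under ring homomorphisms -/

section Hom

variable {S : Type*} [CommRing S] (g : EisensteinInt →+* S)

lemma map_w_sq_add : g w ^ 2 + g w + 1 = 0 := by
  have := congrArg g w_sq_add
  simpa using this

lemma map_eq (z : EisensteinInt) : g z = z.re + z.im * g w := by
  conv_lhs => rw [eq_re_add_im z]
  simp

lemma map_star (z : EisensteinInt) : g (star z) = z.re + z.im * g w ^ 2 := by
  rw [star_eq_re_add_im]
  simp

lemma map_w_pow_three : g w ^ 3 = 1 := by
  rw [← map_pow, w_pow_three, map_one]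

end Hom

section Field

variable {F : Type*} [Field F] (g : EisensteinInt →+* F) (h3 : (3 : F) ≠ 0)

include h3

lemma map_w_ne_one : g w ≠ 1 := by
  intro h
  have := map_w_sq_add g
  rw [h] at this
  exact h3 (by linear_combination this)

lemma coords_eq_zero {z : EisensteinInt} (h : g z = 0) (h' : g (star z) = 0) :
    (z.re : F) = 0 ∧ (z.im : F) = 0 := by
  have hw0 : g w ≠ 0 := fun h ↦ by simpa [h] using map_w_pow_three g
  rw [map_eq] at h
  rw [map_star] at h'
  have h1 : (z.im : F) = 0 := by
    have : (z.im : F) * (g w * (g w - 1)) = 0 := by linear_combination h' - h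
    refine (mul_eq_zero.1 this).resolve_right (mul_ne_zero hw0 ?_)
    exact sub_ne_zero.2 (map_w_ne_one g h3)
  exact ⟨by simpa [h1] using h, h1⟩

/-- Cube roots of unity stay distinct where 3 is invertible. Identities between symbol values can
therefore be checked after applying `g`. -/
lemma map_injOn_pow_three {z z' : EisensteinInt} (hz : z ^ 3 = 1) (hz' : z' ^ 3 = 1)
    (h : g z = g z') : z = z' := by
  have h1 := map_w_ne_one g h3
  have key : ∀ u : EisensteinInt, u ^ 3 = 1 → g u = 1 → u = 1 := by
    intro u hu hgu
    rcases eq_of_pow_three_eq_one hu with rfl | rfl | rfl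
    · rfl
    · exact absurd hgu h1
    · refine absurd ?_ h1
      have := map_w_pow_three g
      rw [map_pow] at hgu
      linear_combination this - g w * hgu
  have h2 : z * z' ^ 2 = 1 := by
    refine key _ ?_ ?_
    · rw [mul_pow, hz, ← pow_mul, mul_comm 2 3, pow_mul, hz']; ring
    · rw [map_mul, h, ← map_mul, ← pow_succ', hz', map_one]
  calc z = z * z' ^ 3 := by rw [hz', mul_one]
    _ = z * z' ^ 2 * z' := by ring
    _ = z' := by rw [h2, one_mul]

end Field

/-! ### Cubic characters and their Jacobi sums -/

section Character

variable {q : ℕ} [Fact q.Prime]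

lemma three_ne_zero_of_ne (hq : q ≠ 3) {F : Type*} [Field F] [CharP F q] : (3 : F) ≠ 0 := by
  intro h
  rw [show (3 : F) = (3 : ℕ) by norm_num, CharP.cast_eq_zero_iff F q] at h
  exact hq ((Nat.prime_dvd_prime_iff_eq Fact.out Nat.prime_three).1 h)

lemma mulChar_pow_three {F : Type*} [Field F] {R : Type*} [CommRing R] {χ : MulChar F R}
    (hχ : orderOf χ = 3) {t : F} (ht : t ≠ 0) : χ t ^ 3 = 1 := by
  rw [← MulChar.pow_apply' χ three_ne_zero, ← hχ, pow_orderOf_eq_one,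
    MulChar.one_apply (isUnit_iff_ne_zero.2 ht)]

/-- For any `χ` of order 3, `f ∘ χ` and `t ↦ t ^ ((q - 1) / 3)` take primitive cube roots of unity
at a generator. So they agree, or agree once `χ` is replaced by `χ ^ 2`. -/
lemma exists_cubicChar (hq : q % 3 = 1) (f : EisensteinInt →+* ZMod q) :
    ∃ χ : MulChar (ZMod q) EisensteinInt, orderOf χ = 3 ∧ ∀ t, f (χ t) = t ^ ((q - 1) / 3) := by
  have hq1 := (Fact.out (p := q.Prime)).one_lt
  have h3 : (3 : ZMod q) ≠ 0 := three_ne_zero_of_ne (q := q) (by omega)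
  obtain ⟨χ, hχ⟩ := MulChar.exists_mulChar_orderOf (ZMod q) (n := 3)
    (by rw [ZMod.card]; omega) isPrimitiveRoot_w
  obtain ⟨γ, hγ⟩ := IsCyclic.exists_generator (α := (ZMod q)ˣ)
  have hγo : orderOf γ = q - 1 := by
    rw [orderOf_eq_card_of_forall_mem_zpowers hγ, Nat.card_eq_fintype_card, ZMod.card_units]
  set c := f (χ γ) with hc
  set d := (γ : ZMod q) ^ ((q - 1) / 3) with hd
  have hgen : ∀ t : ZMod q, t ≠ 0 → ∃ i : ℕ, t = (γ : ZMod q) ^ i := by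
    intro t ht
    obtain ⟨i, hi⟩ := (mem_powers_iff_mem_zpowers (x := γ)).2 (hγ (Units.mk0 t ht))
    exact ⟨i, by simpa using (congrArg Units.val hi).symm⟩
  have hc3 : c ^ 3 = 1 := by rw [hc, ← map_pow, mulChar_pow_three hχ γ.ne_zero, map_one]
  have hd3 : d ^ 3 = 1 := by
    rw [hd, ← pow_mul, Nat.div_mul_cancel (by omega), ← hγo, ← Units.val_pow_eq_pow_val,
      pow_orderOf_eq_one, Units.val_one]
  have hc1 : c ≠ 1 := by
    intro h
    have h1 : χ γ = 1 := map_injOn_pow_three f h3 (mulChar_pow_three hχ γ.ne_zero) (one_pow 3)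
      (by rw [← hc, h, map_one])
    have : χ = 1 := by
      refine MulChar.ext fun t ↦ ?_
      obtain ⟨i, hi⟩ := hgen t t.ne_zero
      rw [hi, map_pow, h1, one_pow, ← hi, MulChar.one_apply_coe]
    rw [this, orderOf_one] at hχ
    omega
  have hd1 : d ≠ 1 := by
    intro h
    have h1 : γ ^ ((q - 1) / 3) = 1 := Units.ext (by simpa [hd] using h)
    have h2 := Nat.le_of_dvd (by omega) (orderOf_dvd_of_pow_eq_one h1)
    omega
  have hcq : c ^ 2 + c + 1 = 0 := by
    refine (mul_eq_zero.1 (?_ : (c - 1) * _ = 0)).resolve_left (sub_ne_zero.2 hc1)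
    linear_combination hc3
  have hdq : d ^ 2 + d + 1 = 0 := by
    refine (mul_eq_zero.1 (?_ : (d - 1) * _ = 0)).resolve_left (sub_ne_zero.2 hd1)
    linear_combination hd3
  have hcd : (c - d) * (c - d ^ 2) = 0 := by linear_combination hcq - c * hdq + hd3
  have hk : (q - 1) / 3 ≠ 0 := by omega
  rcases mul_eq_zero.1 hcd with h | h
  · refine ⟨χ, hχ, fun t ↦ ?_⟩
    by_cases ht : t = 0
    · rw [ht, MulChar.map_zero, map_zero, zero_pow hk]
    · obtain ⟨i, rfl⟩ := hgen t ht
      rw [map_pow, map_pow, ← hc, sub_eq_zero.1 h, hd, ← pow_mul, ← pow_mul, mul_comm]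
  · refine ⟨χ ^ 2, ?_, fun t ↦ ?_⟩
    · rw [Nat.Coprime.orderOf_pow (by rw [hχ]; norm_num), hχ]
    · by_cases ht : t = 0
      · rw [ht, MulChar.map_zero, map_zero, zero_pow hk]
      · obtain ⟨i, rfl⟩ := hgen t ht
        rw [MulChar.pow_apply' _ two_ne_zero, map_pow, map_pow, map_pow, ← hc, sub_eq_zero.1 h]
        have : (d ^ 2) ^ 2 = d := by linear_combination d * hd3
        rw [pow_right_comm, this, hd, pow_right_comm]

/-- The image is the sum over `ZMod q` of `t^k (1-t)^k` with `k = (q-1)/3`. Its degree `2k` is below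
`q - 1`, so every power sum vanishes. -/
lemma map_jacobiSum_eq_zero (hq : q % 3 = 1) {f : EisensteinInt →+* ZMod q}
    {χ : MulChar (ZMod q) EisensteinInt} (hf : ∀ t, f (χ t) = t ^ ((q - 1) / 3)) :
    f (jacobiSum χ χ) = 0 := by
  have hq1 := (Fact.out (p := q.Prime)).one_lt
  set k := (q - 1) / 3 with hk
  have h1 : ∀ t : ZMod q, f (χ t * χ (1 - t)) =
      ∑ i ∈ Finset.range (k + 1), (-1) ^ i * (k.choose i : ZMod q) * t ^ (k + i) := by
    intro t
    rw [map_mul, hf, hf, sub_eq_neg_add, add_pow, Finset.mul_sum]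
    refine Finset.sum_congr rfl fun i _ ↦ ?_
    rw [neg_pow, one_pow, pow_add]
    ring
  rw [jacobiSum, map_sum, Finset.sum_congr rfl fun t _ ↦ h1 t, Finset.sum_comm]
  refine Finset.sum_eq_zero fun i hi ↦ ?_
  rw [Finset.mem_range] at hi
  rw [← Finset.mul_sum, FiniteField.sum_pow_lt_card_sub_one, mul_zero]
  rw [ZMod.card]
  omega

lemma ringHomComp_star {χ : MulChar (ZMod q) EisensteinInt} (hχ : orderOf χ = 3) :
    χ.ringHomComp (starRingEnd EisensteinInt) = χ⁻¹ := by
  have h2 : χ⁻¹ = χ ^ 2 := by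
    rw [inv_eq_iff_mul_eq_one, ← pow_succ', show 2 + 1 = orderOf χ from hχ.symm,
      pow_orderOf_eq_one]
  rw [h2]
  refine MulChar.ext fun t ↦ ?_
  rw [MulChar.ringHomComp_apply, starRingEnd_apply,
    star_eq_sq_of_pow_three_eq_one (mulChar_pow_three hχ t.ne_zero), MulChar.pow_apply' _ two_ne_zero]

lemma jacobiSum_mul_star {χ : MulChar (ZMod q) EisensteinInt} (hχ : orderOf χ = 3) :
    jacobiSum χ χ * star (jacobiSum χ χ) = q := by
  -- The norm formula for Jacobi sums is applied with values in a field, then pulled back along the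
  -- injection.
  let K := FractionRing EisensteinInt
  let i : EisensteinInt →+* K := algebraMap _ _
  have hi : Function.Injective i := IsFractionRing.injective _ _
  have hne : χ ≠ 1 := by rintro rfl; simp at hχ
  have hne' : χ.ringHomComp i ≠ 1 := (MulChar.ringHomComp_ne_one_iff hi).2 hne
  have hne2 : χ.ringHomComp i * χ.ringHomComp i ≠ 1 := by
    rw [← MulChar.ringHomComp_mul, MulChar.ringHomComp_ne_one_iff hi, ← pow_two]
    intro h
    have := orderOf_dvd_of_pow_eq_one h
    rw [hχ] at this
    norm_num at this
  have : CharZero K := charZero_of_injective_algebraMap hi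
  have h := jacobiSum_mul_jacobiSum_inv (F := ZMod q) (F' := K)
    (by rw [ringChar.eq_zero, ZMod.ringChar_zmod_n]; exact (Fact.out (p := q.Prime)).ne_zero.symm)
    hne' hne' hne2
  rw [MulChar.ringHomComp_inv, ← ringHomComp_star hχ, jacobiSum_ringHomComp,
    jacobiSum_ringHomComp, jacobiSum_ringHomComp, starRingEnd_apply, ← map_mul, ZMod.card] at h
  exact hi (by simpa using h)

lemma exists_jacobiSum_eq (hq : q % 3 = 1) {χ : MulChar (ZMod q) EisensteinInt}
    (hχ : orderOf χ = 3) : ∃ z, jacobiSum χ χ = -1 + 3 * z := by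
  have hq1 := (Fact.out (p := q.Prime)).one_lt
  have h3 : χ ^ 3 = 1 := by rw [← hχ, pow_orderOf_eq_one]
  obtain ⟨z, -, hz⟩ := exists_jacobiSum_eq_neg_one_add (F := ZMod q) (n := 3) (by norm_num) h3 h3
    (by rw [ZMod.card]; omega) isPrimitiveRoot_w
  refine ⟨-z * w, ?_⟩
  rw [hz]
  -- `(w - 1)^2 = -3w`.
  linear_combination z * w_sq_add

/-- The Gauss sum satisfies `G^3 = qJ`. As `l^2 ≡ 1` mod 3, applying the `l`-Frobenius twice only
shifts the additive character by `l^2`, so `G^(l^2) = χ(l)^(-2) G`, and `χ(l)^(-2) = χ(l)`. -/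
lemma map_jacobiSum_pow {l : ℕ} [Fact l.Prime] {F : Type*} [Field F] [CharP F l] [IsAlgClosed F]
    (hl : l ≠ 3) (hlq : l ≠ q) {χ : MulChar (ZMod q) EisensteinInt} (hχ : orderOf χ = 3)
    (g : EisensteinInt →+* F) :
    ((q : F) * g (jacobiSum χ χ)) ^ ((l ^ 2 - 1) / 3) = g (χ l) := by
  have h3 : (3 : F) ≠ 0 := three_ne_zero_of_ne hl
  have hq := Fact.out (p := q.Prime)
  have hqF : (q : F) ≠ 0 := by
    rw [Ne, CharP.cast_eq_zero_iff F l, Nat.prime_dvd_prime_iff_eq Fact.out hq]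
    exact hlq
  have hlZ : (l : ZMod q) ≠ 0 := by
    rw [Ne, ZMod.natCast_eq_zero_iff, Nat.prime_dvd_prime_iff_eq hq Fact.out]
    exact hlq.symm
  have : NeZero (q : F) := ⟨hqF⟩
  obtain ⟨ζ, hζ⟩ := HasEnoughRootsOfUnity.exists_primitiveRoot F q
  set ψ := AddChar.zmodChar q hζ.pow_eq_one with hψ
  have hψp : ψ.IsPrimitive := AddChar.zmodChar_primitive_of_primitive_root q hζ
  set χ' := χ.ringHomComp g with hχ'
  have hval : ∀ t, χ' t = g (χ t) := fun t ↦ rfl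
  have ho : orderOf χ' = 3 := by
    refine orderOf_eq_prime ?_ ?_
    · refine MulChar.ext fun t ↦ ?_
      rw [MulChar.pow_apply' _ three_ne_zero, hval, ← map_pow, mulChar_pow_three hχ t.ne_zero,
        map_one, MulChar.one_apply_coe]
    · intro h
      have : χ = 1 := by
        refine MulChar.ext fun t ↦ ?_
        rw [MulChar.one_apply_coe]
        refine map_injOn_pow_three g h3 (mulChar_pow_three hχ t.ne_zero) (one_pow 3) ?_
        rw [← hval, h, MulChar.one_apply_coe, map_one]
      rw [this, orderOf_one] at hχ
      omega
  set G := gaussSum χ' ψ with hG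
  have hm1 : χ' (-1) = 1 := by
    have h1 := mulChar_pow_three ho (neg_ne_zero.2 (one_ne_zero (α := ZMod q)))
    have h2 : χ' (-1) ^ 2 = 1 := by rw [← map_pow]; simp
    linear_combination h1 - χ' (-1) * h2
  have hG3 : G ^ 3 = q * g (jacobiSum χ χ) := by
    have h1 := gaussSum_pow_eq_prod_jacobiSum (χ := χ') (ψ := ψ) (by omega) hψp
    rw [ho, hm1, ZMod.card, one_mul] at h1
    rw [hG, h1, show Finset.Ico 1 (3 - 1) = {1} from rfl, Finset.prod_singleton, pow_one, hχ',
      jacobiSum_ringHomComp]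
  have hG0 : G ≠ 0 := by
    intro h
    have h1 := congrArg g (jacobiSum_mul_star hχ)
    rw [map_mul, map_natCast] at h1
    have h2 : g (jacobiSum χ χ) = 0 := by
      rw [h, zero_pow three_ne_zero] at hG3
      exact (mul_eq_zero.1 hG3.symm).resolve_left hqF
    rw [h2, zero_mul] at h1
    exact hqF h1.symm
  have hl3 : l ^ 2 % 3 = 1 := by
    have : l % 3 ≠ 0 := fun h ↦
      hl ((Nat.prime_dvd_prime_iff_eq Nat.prime_three Fact.out).1 (Nat.dvd_of_mod_eq_zero h)).symm
    rcases (by omega : l % 3 = 1 ∨ l % 3 = 2) with h | h <;> simp [Nat.pow_mod, h]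
  have hl2 : l ^ 2 = 3 * ((l ^ 2 - 1) / 3) + 1 := by omega
  have hfrob : G ^ (l ^ 2) = gaussSum χ' (ψ.mulShift ((l : ZMod q) ^ 2)) := by
    rw [pow_two, pow_mul, hG, gaussSum_frob l, gaussSum_frob l, ← pow_mul, ← pow_mul, ← pow_two]
    congr 1
    · conv_lhs => rw [hl2, pow_succ, pow_mul, ← ho, pow_orderOf_eq_one, one_pow, one_mul]
    · rw [AddChar.pow_mulShift]
      push_cast
      rfl
  have hshift := gaussSum_mulShift χ' ψ (Units.mk0 ((l : ZMod q) ^ 2) (pow_ne_zero 2 hlZ))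
  rw [Units.val_mk0, ← hfrob, ← hG, map_pow] at hshift
  have hl1 := mulChar_pow_three ho hlZ
  rw [hl2, pow_succ G, pow_mul G, hG3] at hshift
  rw [← hval]
  have h4 : χ' l ^ 2 * (q * g (jacobiSum χ χ)) ^ ((l ^ 2 - 1) / 3) = 1 :=
    mul_right_cancel₀ hG0 (by rw [one_mul, mul_assoc, hshift])
  linear_combination χ' l * h4 - (q * g (jacobiSum χ χ)) ^ ((l ^ 2 - 1) / 3) * hl1

/-- Comparing the previous identity for `g` and for `g` composed with conjugation cancels the power
of `q`. -/
lemma map_jacobiSum_pow_eq {l : ℕ} [Fact l.Prime] {F : Type*} [Field F] [CharP F l] [IsAlgClosed F]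
    (hl : l ≠ 3) (hlq : l ≠ q) {χ : MulChar (ZMod q) EisensteinInt} (hχ : orderOf χ = 3)
    (g : EisensteinInt →+* F) :
    g (jacobiSum χ χ) ^ ((l ^ 2 - 1) / 3) =
      g (χ l) ^ 2 * g (star (jacobiSum χ χ)) ^ ((l ^ 2 - 1) / 3) := by
  have hq := Fact.out (p := q.Prime)
  have hqF : (q : F) ≠ 0 := by
    rw [Ne, CharP.cast_eq_zero_iff F l, Nat.prime_dvd_prime_iff_eq Fact.out hq]
    exact hlq
  have hlZ : (l : ZMod q) ≠ 0 := by
    rw [Ne, ZMod.natCast_eq_zero_iff, Nat.prime_dvd_prime_iff_eq hq Fact.out]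
    exact hlq.symm
  have h1 := map_jacobiSum_pow hl hlq hχ g
  have h2 := map_jacobiSum_pow hl hlq hχ (g.comp (starRingEnd EisensteinInt))
  have h3 := mulChar_pow_three hχ hlZ
  simp only [RingHom.comp_apply, starRingEnd_apply] at h2
  rw [star_eq_sq_of_pow_three_eq_one h3, map_pow] at h2
  have h4 : g (χ l) ^ 3 = 1 := by rw [← map_pow, h3, map_one]
  refine mul_left_cancel₀ (pow_ne_zero ((l ^ 2 - 1) / 3) hqF) ?_
  rw [← mul_pow, h1, mul_left_comm, ← mul_pow, h2]
  linear_combination -g (χ l) * h4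

end Character

end EisensteinInt

namespace EisensteinInt

open QuadraticAlgebra

/-! ### Rational cubic reciprocity -/

/-- `X` is a cubic residue symbol modulo `a`, related by reciprocity to the cubic character of `a`
modulo rational primes. -/
structure IsCubicSymbol (a : EisensteinInt) (X : EisensteinInt →* EisensteinInt) : Prop where
  pow_four : ∀ u, X u ^ 4 = X u
  congr : ∀ u v, a ∣ u - v → X u = X v
  map_w : X w = w ^ ((a.norm.natAbs - 1) / 3)
  reciprocity : ∀ (l : ℕ) [Fact l.Prime], l ≠ 3 → ¬(l : ℤ) ∣ a.norm →
    ∀ g : EisensteinInt →+* AlgebraicClosure (ZMod l),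
      g a ^ ((l ^ 2 - 1) / 3) = g (X l) ^ 2 * g (star a) ^ ((l ^ 2 - 1) / 3)

lemma norm_emod_three {a : EisensteinInt} (him : 3 ∣ a.im) (hre : ¬3 ∣ a.norm) :
    a.norm % 3 = 1 := by
  rw [norm_eq] at hre ⊢
  obtain ⟨b, hb⟩ := him
  rw [hb] at hre ⊢
  have h : a.re ^ 2 - a.re * (3 * b) + (3 * b) ^ 2 = a.re ^ 2 + 3 * (3 * b ^ 2 - a.re * b) := by ring
  rw [h] at hre ⊢
  have : a.re ^ 2 % 3 = 0 ∨ a.re ^ 2 % 3 = 1 := by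
    rcases (by omega : a.re % 3 = 0 ∨ a.re % 3 = 1 ∨ a.re % 3 = 2) with h | h | h <;>
      simp [pow_two, Int.mul_emod, h]
  omega

lemma eq_intCast_mul {q : ℕ} {z : EisensteinInt} (h1 : (z.re : ZMod q) = 0)
    (h2 : (z.im : ZMod q) = 0) : ∃ z', z = (q : EisensteinInt) * z' := by
  rw [ZMod.intCast_zmod_eq_zero_iff_dvd] at h1 h2
  obtain ⟨r, hr⟩ := h1
  obtain ⟨s, hs⟩ := h2
  exact ⟨⟨r, s⟩, by ext <;> simp [hr, hs]⟩

lemma IsCubicSymbol.one {a : EisensteinInt} (ha : a.norm = 1) (him : 3 ∣ a.im) :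
    IsCubicSymbol a 1 := by
  have h0 : a.im = 0 := by
    rw [norm_eq] at ha
    obtain ⟨b, hb⟩ := him
    have : b ^ 2 < 1 := by rw [hb] at ha; nlinarith [sq_nonneg (2 * a.re - 3 * b)]
    have : b = 0 := by
      by_contra h
      have := Int.one_le_abs h
      nlinarith [sq_abs b]
    rw [hb, this, mul_zero]
  refine ⟨fun u ↦ by simp, fun u v _ ↦ rfl, by simp [ha], fun l _ _ _ g ↦ ?_⟩
  rw [map_eq, map_star, h0]
  simp

/-- Induction on the norm. The hypothesis `a ∣ w - m` makes every class modulo `a` rational, so each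
prime `q ∣ N(a)` is split. A Jacobi sum `J` of norm `q` then divides `a`, and `J ≡ -1` mod 3 keeps
`3 ∣ im` for the quotient. -/
lemma exists_isCubicSymbol (N : ℕ) : ∀ a : EisensteinInt, a.norm = N → 3 ∣ a.im → ¬3 ∣ a.norm →
    ∀ m : ℤ, a ∣ w - m → ∃ X, IsCubicSymbol a X := by
  induction N using Nat.strong_induction_on with
  | _ N ih =>
  intro a haN him h3 m hm
  have hN0 : N ≠ 0 := by
    rintro rfl
    rw [haN] at h3
    simp at h3
  by_cases hN1 : N = 1
  · exact ⟨1, IsCubicSymbol.one (by rw [haN, hN1]; rfl) him⟩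
  obtain ⟨q, hq, hqN⟩ := Nat.exists_prime_and_dvd hN1
  have := Fact.mk hq
  have hq3 : q ≠ 3 := by
    rintro rfl
    exact h3 (haN ▸ Int.natCast_dvd_natCast.2 hqN)
  have h3q : (3 : ZMod q) ≠ 0 := three_ne_zero_of_ne hq3
  obtain ⟨v, hv⟩ := hm
  have hNq : (a.norm : ZMod q) = 0 := by
    rw [haN, Int.cast_natCast, ZMod.natCast_eq_zero_iff]
    exact hqN
  have hmq : (m : ZMod q) ^ 2 + m + 1 = 0 := by
    have h1 : QuadraticAlgebra.norm (w - (m : EisensteinInt)) = m ^ 2 + m + 1 := by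
      rw [norm_eq]; simp [w]
    rw [hv, map_mul] at h1
    have h2 := congrArg (Int.cast : ℤ → ZMod q) h1
    push_cast at h2
    rw [← h2, hNq, zero_mul]
  set f := liftHom (m : ZMod q) hmq with hf
  have hfw : f w = m := liftHom_w _ _
  have hq1 : q % 3 = 1 := by
    have hm1 : (m : ZMod q) ≠ 1 := hfw ▸ map_w_ne_one f h3q
    have hm3 : (m : ZMod q) ^ 3 = 1 := hfw ▸ map_w_pow_three f
    have hm0 : (m : ZMod q) ≠ 0 := fun h ↦ by simp [h] at hm3
    have h1 : orderOf (m : ZMod q) = 3 := orderOf_eq_prime hm3 hm1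
    have h2 := orderOf_dvd_of_pow_eq_one (ZMod.pow_card_sub_one_eq_one hm0)
    rw [h1] at h2
    have := hq.two_le
    omega
  -- Modulo `a` the integer `a.re + a.im * m` is `a` itself, so its norm, which is its square, is
  -- divisible by `N(a)`.
  have hfa : f a = 0 := by
    have h1 : ((a.re + a.im * m : ℤ) : EisensteinInt) = a * (1 - a.im * v) := by
      push_cast
      linear_combination -eq_re_add_im a - (a.im : EisensteinInt) * hv
    have h2 := congrArg QuadraticAlgebra.norm h1
    rw [map_mul, QuadraticAlgebra.norm_intCast] at h2
    have h3 := congrArg (Int.cast : ℤ → ZMod q) h2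
    push_cast at h3
    rw [hNq, zero_mul] at h3
    rw [map_eq, hfw]
    exact pow_eq_zero_iff two_ne_zero |>.1 h3
  obtain ⟨χ, hχ, hfχ⟩ := exists_cubicChar hq1 f
  have hfJ := map_jacobiSum_eq_zero hq1 hfχ
  have hJJ := jacobiSum_mul_star hχ
  obtain ⟨z, hJz⟩ := exists_jacobiSum_eq hq1 hχ
  have hrec := fun (l : ℕ) (hl : Fact l.Prime) (h : l ≠ 3) (h' : l ≠ q) ↦
    map_jacobiSum_pow_eq (F := AlgebraicClosure (ZMod l)) h h' hχ
  generalize jacobiSum χ χ = J at hfJ hJJ hJz hrec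
  have hq0 : (q : EisensteinInt) ≠ 0 := Nat.cast_ne_zero.2 hq.ne_zero
  have hJ0 : star J ≠ 0 := fun h ↦ by
    rw [h, mul_zero] at hJJ
    exact hq0 hJJ.symm
  -- Both `f` and its conjugate kill `a * star J`, so `q = J * star J` divides it.
  obtain ⟨a', ha'⟩ : ∃ a', a = J * a' := by
    obtain ⟨h1, h2⟩ := coords_eq_zero f h3q (z := a * star J) (by rw [map_mul, hfa, zero_mul])
      (by rw [star_mul', star_star, map_mul, hfJ, mul_zero])
    obtain ⟨a', ha'⟩ := eq_intCast_mul h1 h2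
    refine ⟨a', mul_right_cancel₀ hJ0 ?_⟩
    rw [ha', ← hJJ]
    ring
  have hJN : J.norm = q := by
    have h1 := mul_star_eq_norm J
    rw [hJJ] at h1
    exact_mod_cast h1.symm
  have hnorm : a.norm = q * a'.norm := by rw [ha', map_mul, hJN]
  have him' : 3 ∣ a'.im := by
    have h1 := congrArg QuadraticAlgebra.im ha'
    rw [hJz] at h1
    simp [im_mul] at h1
    obtain ⟨b, hb⟩ := him
    exact ⟨-b + z.re * a'.im + z.im * a'.re - z.im * a'.im, by linarith⟩
  have h3' : ¬3 ∣ a'.norm := fun h ↦ h3 (hnorm ▸ Dvd.dvd.mul_left h _)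
  have hN' : a'.norm = a'.norm.natAbs := (Int.natAbs_of_nonneg (norm_nonneg a')).symm
  have hNN : N = q * a'.norm.natAbs := by
    have : (N : ℤ) = q * a'.norm.natAbs := by rw [← haN, hnorm, ← hN']
    exact_mod_cast this
  have hlt : a'.norm.natAbs < N := by
    have h1 : 0 < a'.norm.natAbs := by
      rcases Nat.eq_zero_or_pos a'.norm.natAbs with h | h
      · rw [h, mul_zero] at hNN
        exact absurd hNN hN0
      · exact h
    rw [hNN]
    nlinarith [hq.two_le]
  obtain ⟨X', hX'⟩ := ih _ hlt a' hN' him' h3' m ((Dvd.intro_left J ha'.symm).trans ⟨v, hv⟩)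
  refine ⟨X' * χ.toMonoidHom.comp f.toMonoidHom, ?_, ?_, ?_, ?_⟩
  · intro u
    change (X' u * χ (f u)) ^ 4 = X' u * χ (f u)
    rw [mul_pow, hX'.pow_four]
    by_cases hu : f u = 0
    · rw [hu, MulChar.map_zero]; ring
    · linear_combination X' u * χ (f u) * mulChar_pow_three hχ hu
  · intro u v huv
    change X' u * χ (f u) = X' v * χ (f v)
    rw [hX'.congr u v ((Dvd.intro_left J ha'.symm).trans huv)]
    obtain ⟨t, ht⟩ := huv
    have : f u - f v = 0 := by rw [← map_sub, ht, map_mul, hfa, zero_mul]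
    rw [sub_eq_zero.1 this]
  · change X' w * χ (f w) = _
    have hχw : χ (f w) = w ^ ((q - 1) / 3) := by
      have hfw0 : f w ≠ 0 := fun h ↦ by simpa [h] using map_w_pow_three f
      refine map_injOn_pow_three f h3q (mulChar_pow_three hχ hfw0) ?_ ?_
      · rw [← pow_mul, mul_comm, pow_mul, w_pow_three, one_pow]
      · rw [hfχ, map_pow]
    rw [hX'.map_w, hχw, ← pow_add, haN, Int.natAbs_natCast, hNN]
    have h1 := norm_emod_three him' h3'
    obtain ⟨s, hs⟩ : ∃ s, a'.norm.natAbs = 3 * s + 1 := ⟨a'.norm.natAbs / 3, by omega⟩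
    obtain ⟨t, ht⟩ : ∃ t, q = 3 * t + 1 := ⟨q / 3, by omega⟩
    rw [hs, ht, show (3 * t + 1) * (3 * s + 1) - 1 = 3 * (3 * (s * t) + (s + t)) by
      rw [Nat.sub_eq_iff_eq_add (by nlinarith)]; ring]
    simp only [Nat.add_sub_cancel, Nat.mul_div_cancel_left _ (show 0 < 3 by norm_num)]
    rw [pow_add w (3 * (s * t)), pow_mul, w_pow_three, one_pow, one_mul]
  · intro l hl hl3 hlN g
    have hlq : l ≠ q := by
      rintro rfl
      exact hlN (hnorm ▸ Dvd.intro _ rfl)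
    have hla' : ¬(l : ℤ) ∣ a'.norm := fun h ↦ hlN (hnorm ▸ Dvd.dvd.mul_left h _)
    change _ = g (X' l * χ (f l)) ^ 2 * _
    have h1 := hrec l hl hl3 hlq g
    have h2 := hX'.reciprocity l hl3 hla' g
    rw [ha', star_mul', map_mul g, map_mul g, map_mul g, mul_pow, mul_pow, mul_pow, h1, h2,
      map_natCast f]
    ring

lemma exists_dvd_w_sub {a : EisensteinInt} (h : IsCoprime a.re a.im) : ∃ m : ℤ, a ∣ w - m := by
  obtain ⟨u, v, huv⟩ := h
  -- The cofactor is chosen so that the product has imaginary part `u * a.re + v * a.im = 1`.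
  refine ⟨-(a * ⟨v + u, u⟩).re, ⟨v + u, u⟩, ?_⟩
  ext
  · simp [w]
  · simp [w, im_mul]
    linear_combination -huv

/-! ### Values of the symbol at rational integers -/

lemma exists_hom_algebraicClosure {l : ℕ} [Fact l.Prime] (hl : l ≠ 3) :
    Nonempty (EisensteinInt →+* AlgebraicClosure (ZMod l)) := by
  have h3 : (3 : AlgebraicClosure (ZMod l)) ≠ 0 := three_ne_zero_of_ne hl
  have : NeZero ((3 : ℕ) : AlgebraicClosure (ZMod l)) := ⟨by exact_mod_cast h3⟩
  obtain ⟨ζ, hζ⟩ := HasEnoughRootsOfUnity.exists_primitiveRoot (AlgebraicClosure (ZMod l)) 3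
  refine ⟨liftHom ζ ?_⟩
  refine (mul_eq_zero.1 (?_ : (ζ - 1) * _ = 0)).resolve_left
    (sub_ne_zero.2 (hζ.ne_one (by norm_num)))
  linear_combination hζ.pow_eq_one

lemma w_pow_eq_of_modEq {i j : ℕ} (h : (3 * i : ℤ) ≡ 3 * j [ZMOD 9]) : w ^ i = w ^ j := by
  have h' : i % 3 = j % 3 := by
    have : (3 * i : ℤ) % 9 = 3 * j % 9 := h
    omega
  rw [pow_eq_pow_mod i w_pow_three, pow_eq_pow_mod j w_pow_three, h']

lemma exists_mod_nine {c : ℤ} (h : c % 3 = 1) : ∃ i : ℕ, (3 * i + 1 : ℤ) ≡ c [ZMOD 9] :=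
  ⟨(c % 9 / 3).toNat, by unfold Int.ModEq; omega⟩

lemma sq_emod_three {c : ℤ} (h : ¬3 ∣ c) : c ^ 2 % 3 = 1 := by
  rcases (by omega : c % 3 = 1 ∨ c % 3 = 2) with h | h <;> simp [pow_two, Int.mul_emod, h]

namespace IsCubicSymbol

variable {a : EisensteinInt} {X : EisensteinInt →* EisensteinInt} (hX : IsCubicSymbol a X)

include hX

lemma pow_three {c : ℤ} (h : IsCoprime c a.norm) : X c ^ 3 = 1 := by
  obtain ⟨d, e, hde⟩ := h
  have h1 : X (d * c) = X 1 := by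
    refine hX.congr _ _ ⟨-(star a * e), ?_⟩
    rw [mul_neg, ← mul_assoc, mul_star_eq_norm]
    have := congrArg (Int.cast : ℤ → EisensteinInt) hde
    push_cast at this
    linear_combination this
  rw [map_mul, map_one] at h1
  have h2 := hX.pow_four c
  linear_combination (X d) * h2 - (X c ^ 3 - 1) * h1

lemma map_neg_one : X (-1) = 1 := by
  have h1 : X (-1) ^ 2 = 1 := by rw [← map_pow]; simp
  have h2 := hX.pow_four (-1)
  linear_combination (X (-1) ^ 2 + 1) * h1 - h2

lemma map_neg (u : EisensteinInt) : X (-u) = X u := by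
  rw [show -u = -1 * u by ring, map_mul, hX.map_neg_one, one_mul]

lemma map_intCast_natAbs (c : ℤ) : X (c.natAbs : EisensteinInt) = X c := by
  rcases Int.natAbs_eq c with h | h
  · conv_rhs => rw [h]
    simp
  · conv_rhs => rw [h]
    rw [Int.cast_neg, hX.map_neg, Int.cast_natCast]

omit hX in
-- On integers prime to 3, `c ↦ w ^ ((c^2 - 1)/3)` is multiplicative: `(1+3s)(1+3t) = 1 + 3(s+t) +
-- 9st`.
lemma map_natCast_of_primes (e : ℕ) (c : ℕ) (h3 : ¬3 ∣ c)
    (h : ∀ l : ℕ, l.Prime → l ∣ c → X l = w ^ (e * ((l ^ 2 - 1) / 3))) :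
    X c = w ^ (e * ((c ^ 2 - 1) / 3)) := by
  induction c using Nat.recOnMul with
  | zero => simp at h3
  | one => simp
  | prime p hp => exact h p hp dvd_rfl
  | mul b c hb hc =>
    have h3b : ¬3 ∣ b := fun h' ↦ h3 (h'.mul_right _)
    have h3c : ¬3 ∣ c := fun h' ↦ h3 (h'.mul_left _)
    rw [Nat.cast_mul, map_mul, hb h3b fun l hl hlb ↦ h l hl (hlb.mul_right _),
      hc h3c fun l hl hlc ↦ h l hl (hlc.mul_left _), ← pow_add, ← mul_add, pow_mul, pow_mul]
    have key : ∀ k : ℕ, ¬3 ∣ k → ∃ s, k ^ 2 = 3 * s + 1 := by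
      intro k hk
      have : k ^ 2 % 3 = 1 := by
        rcases (by omega : k % 3 = 1 ∨ k % 3 = 2) with h | h <;> simp [Nat.pow_mod, h]
      exact ⟨k ^ 2 / 3, by omega⟩
    obtain ⟨s, hs⟩ := key b h3b
    obtain ⟨t, ht⟩ := key c h3c
    rw [mul_pow, hs, ht, show (3 * s + 1) * (3 * t + 1) - 1 = 3 * (3 * (s * t) + (s + t)) by
      rw [Nat.sub_eq_iff_eq_add (by nlinarith)]; ring]
    simp only [Nat.add_sub_cancel, Nat.mul_div_cancel_left _ (show 0 < 3 by norm_num)]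
    have h9 : (w ^ e) ^ (3 * (s * t)) = 1 := by
      rw [← pow_mul, mul_left_comm, pow_mul, w_pow_three, one_pow]
    rw [pow_add (w ^ e) (3 * (s * t)), h9, one_mul]

lemma map_intCast_of_primes (e : ℕ) {c : ℤ} (h3 : ¬3 ∣ c)
    (h : ∀ l : ℕ, l.Prime → (l : ℤ) ∣ c → X l = w ^ (e * ((l ^ 2 - 1) / 3))) {i : ℕ}
    (hi : (3 * i + 1 : ℤ) ≡ c ^ 2 [ZMOD 9]) : X c = w ^ (e * i) := by
  have h3' : ¬3 ∣ c.natAbs := fun h' ↦ h3 (by exact_mod_cast Int.natCast_dvd.2 h')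
  have h1 := map_natCast_of_primes e c.natAbs h3' fun l hl hlc ↦ h l hl (Int.natCast_dvd.2 hlc)
  rw [hX.map_intCast_natAbs] at h1
  have hk : c.natAbs ^ 2 % 3 = 1 := by
    rcases (by omega : c.natAbs % 3 = 1 ∨ c.natAbs % 3 = 2) with h | h <;> simp [Nat.pow_mod, h]
  rw [h1, mul_comm e, mul_comm e, pow_mul, pow_mul]
  congr 1
  refine w_pow_eq_of_modEq ?_
  have h2 : (3 * ((c.natAbs ^ 2 - 1) / 3 : ℕ) : ℤ) = c ^ 2 - 1 := by
    have h4 : 3 * ((c.natAbs ^ 2 - 1) / 3) + 1 = c.natAbs ^ 2 := by omega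
    have h5 : ((c.natAbs ^ 2 : ℕ) : ℤ) = c ^ 2 := by rw [Nat.cast_pow, Int.natAbs_sq]
    have h6 := congrArg (Nat.cast : ℕ → ℤ) h4
    push_cast at h6 h5 ⊢
    linarith
  rw [h2]
  have h3 := hi.symm.sub_right 1
  simpa using h3

/-! ### Symbols of 3 and of the coordinates of `a` -/

section Primary

variable (hco : IsCoprime a.re a.im)

include hco

/-- Modulo `l`, `a` and its conjugate become `a.im * w` and `a.im * w^2`, so reciprocity leaves only
powers of `w`. -/
lemma map_prime_of_dvd_re {l : ℕ} (hl : l.Prime) (hl3 : l ≠ 3) (hd : (l : ℤ) ∣ a.re) :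
    X l = w ^ ((l ^ 2 - 1) / 3) := by
  have := Fact.mk hl
  have hlZ : Prime (l : ℤ) := Nat.prime_iff_prime_int.1 hl
  have hB : ¬(l : ℤ) ∣ a.im := fun h ↦ hlZ.not_isUnit (hco.isUnit_of_dvd' hd h)
  have hN : ¬(l : ℤ) ∣ a.norm := by
    rw [norm_eq]
    intro h
    refine hB (hlZ.dvd_of_dvd_pow (n := 2) ?_)
    have h1 := dvd_sub h (hd.mul_right (a.re - a.im))
    convert h1 using 1
    ring
  have hX3 := hX.pow_three ((Prime.coprime_iff_not_dvd hlZ).2 hN)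
  rw [Int.cast_natCast] at hX3
  obtain ⟨g⟩ := exists_hom_algebraicClosure hl3
  have h3 : (3 : AlgebraicClosure (ZMod l)) ≠ 0 := three_ne_zero_of_ne hl3
  have hr := hX.reciprocity l hl3 hN g
  have hA0 : (a.re : AlgebraicClosure (ZMod l)) = 0 := (CharP.intCast_eq_zero_iff _ l _).2 hd
  have hB0 : (a.im : AlgebraicClosure (ZMod l)) ≠ 0 := fun h ↦
    hB ((CharP.intCast_eq_zero_iff _ l _).1 h)
  rw [map_eq, map_star, hA0, zero_add, zero_add, mul_pow, mul_pow, mul_left_comm] at hr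
  have hr := mul_left_cancel₀ (pow_ne_zero _ hB0) hr
  generalize (l ^ 2 - 1) / 3 = n at hr ⊢
  refine map_injOn_pow_three g h3 hX3 ?_ ?_
  · rw [← pow_mul, mul_comm, pow_mul, w_pow_three, one_pow]
  · have h4 : g (X l) ^ 3 = 1 := by rw [← map_pow, hX3, map_one]
    have h5 : (g w ^ n) ^ 3 = 1 := by
      rw [← pow_mul, mul_comm, pow_mul, map_w_pow_three, one_pow]
    rw [pow_right_comm] at hr
    rw [map_pow]
    generalize g w ^ n = t at hr h5 ⊢
    have ht0 : t ≠ 0 := fun h ↦ by simp [h] at h5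
    refine mul_right_cancel₀ ht0 ?_
    linear_combination -(t + g (X l) ^ 2 * t ^ 2) * hr - g (X l) * t * h5 -
      g (X l) * t ^ 4 * h4

/-- Modulo `l`, `a` becomes `a.re * (1 - w)` and its conjugate is `-w^2` times that. The sign
disappears in the power `(l^2 - 1)/3`. -/
lemma map_prime_of_dvd_re_add_im {l : ℕ} (hl : l.Prime) (hl3 : l ≠ 3)
    (hd : (l : ℤ) ∣ a.re + a.im) : X l = w ^ (2 * ((l ^ 2 - 1) / 3)) := by
  have := Fact.mk hl
  have hlZ : Prime (l : ℤ) := Nat.prime_iff_prime_int.1 hl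
  have hA : ¬(l : ℤ) ∣ a.re := fun h ↦ hlZ.not_isUnit (hco.isUnit_of_dvd' h ((dvd_add_right h).1 hd))
  have hN : ¬(l : ℤ) ∣ a.norm := by
    rw [norm_eq]
    intro h
    have h1 : (l : ℤ) ∣ 3 * a.re ^ 2 := by
      have h1 := dvd_sub h (hd.mul_right (a.im - 2 * a.re))
      have e : 3 * a.re ^ 2 = a.re ^ 2 - a.re * a.im + a.im ^ 2 -
        (a.re + a.im) * (a.im - 2 * a.re) := by ring
      rw [e]
      exact h1
    rcases hlZ.dvd_or_dvd h1 with h2 | h2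
    · exact hl3 ((Nat.prime_dvd_prime_iff_eq hl Nat.prime_three).1 (by exact_mod_cast h2))
    · exact hA (hlZ.dvd_of_dvd_pow h2)
  have hX3 := hX.pow_three ((Prime.coprime_iff_not_dvd hlZ).2 hN)
  rw [Int.cast_natCast] at hX3
  obtain ⟨g⟩ := exists_hom_algebraicClosure hl3
  have h3 : (3 : AlgebraicClosure (ZMod l)) ≠ 0 := three_ne_zero_of_ne hl3
  have hr := hX.reciprocity l hl3 hN g
  have hA0 : (a.re : AlgebraicClosure (ZMod l)) ≠ 0 := fun h ↦
    hA ((CharP.intCast_eq_zero_iff _ l _).1 h)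
  have hB : (a.im : AlgebraicClosure (ZMod l)) = -a.re := by
    have := (CharP.intCast_eq_zero_iff (AlgebraicClosure (ZMod l)) l _).2 hd
    push_cast at this
    linear_combination this
  have hw := map_w_sq_add g
  have hw3 := map_w_pow_three g
  have hga : g a = a.re * (1 - g w) := by rw [map_eq, hB]; ring
  have hgs : g (star a) = -1 * (g w ^ 2 * (a.re * (1 - g w))) := by
    rw [map_star, hB]
    linear_combination (a.re : AlgebraicClosure (ZMod l)) * hw - a.re * hw3 -
      (a.re : AlgebraicClosure (ZMod l)) * hw
  have hne : (a.re : AlgebraicClosure (ZMod l)) * (1 - g w) ≠ 0 :=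
    mul_ne_zero hA0 (sub_ne_zero.2 (map_w_ne_one g h3).symm)
  have hneg : (-1 : AlgebraicClosure (ZMod l)) ^ ((l ^ 2 - 1) / 3) = 1 := by
    rcases hl.eq_two_or_odd with h | h
    · subst h
      norm_num
      exact CharTwo.neg_eq 1
    · refine Even.neg_one_pow ?_
      have h1 : l ^ 2 % 2 = 1 := by simp [Nat.pow_mod, h]
      have h2 : l ^ 2 % 4 = 1 := by
        rcases (by omega : l % 4 = 1 ∨ l % 4 = 3) with h | h <;> simp [Nat.pow_mod, h]
      have h3 : l ^ 2 % 3 = 1 := by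
        have : l % 3 ≠ 0 := fun h ↦ hl3
          ((Nat.prime_dvd_prime_iff_eq Nat.prime_three hl).1 (Nat.dvd_of_mod_eq_zero h)).symm
        rcases (by omega : l % 3 = 1 ∨ l % 3 = 2) with h | h <;> simp [Nat.pow_mod, h]
      rw [Nat.even_iff]
      omega
  rw [hgs, hga, mul_pow (-1), hneg, one_mul, mul_pow (g w ^ 2), ← mul_assoc] at hr
  have hr : g (X l) ^ 2 * (g w ^ 2) ^ ((l ^ 2 - 1) / 3) = 1 :=
    mul_right_cancel₀ (pow_ne_zero _ hne) (by rw [one_mul]; exact hr.symm)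
  generalize (l ^ 2 - 1) / 3 = n at hr ⊢
  refine map_injOn_pow_three g h3 hX3 ?_ ?_
  · rw [← pow_mul, mul_comm, pow_mul, w_pow_three, one_pow]
  · have h4 : g (X l) ^ 3 = 1 := by rw [← map_pow, hX3, map_one]
    rw [map_pow, pow_mul]
    generalize (g w ^ 2) ^ n = t at hr ⊢
    linear_combination t * h4 - g (X l) * hr

variable (him : 3 ∣ a.im)

include him

omit hX in
lemma not_dvd_re : ¬3 ∣ a.re := fun h ↦
  (Nat.prime_iff_prime_int.1 Nat.prime_three).not_isUnit (hco.isUnit_of_dvd' h him)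

lemma map_re {i : ℕ} (hi : (3 * i + 1 : ℤ) ≡ a.re ^ 2 [ZMOD 9]) : X a.re = w ^ i := by
  have h3 := not_dvd_re hco him
  have h := hX.map_intCast_of_primes 1 h3 (fun l hl hd ↦ ?_) hi
  · rwa [one_mul] at h
  · rw [one_mul]
    refine hX.map_prime_of_dvd_re hco hl ?_ hd
    rintro rfl
    exact h3 hd

lemma map_re_add_im {i : ℕ} (hi : (3 * i + 1 : ℤ) ≡ (a.re + a.im) ^ 2 [ZMOD 9]) :
    X (a.re + a.im : ℤ) = w ^ (2 * i) := by
  have h3 : ¬3 ∣ a.re + a.im := fun h ↦ not_dvd_re hco him ((dvd_add_left him).1 h)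
  refine hX.map_intCast_of_primes 2 h3 (fun l hl hd ↦ ?_) hi
  refine hX.map_prime_of_dvd_re_add_im hco hl ?_ hd
  rintro rfl
  exact h3 hd

/-- Modulo `a`, `re + im ≡ re (1 - w^2)` and `re ≡ -im w`, while `(1 - w^2)^2 = -3w^2`. The known
symbols of `re`, `re + im` and `w` thus determine those of 3 and `im`; the exponents are then
compared mod 9 using `3 ∣ im`. -/
lemma map_three_and_map_im {j : ℕ} (hj : (3 * j : ℤ) ≡ a.re * a.im [ZMOD 9]) :
    X 3 = w ^ j ∧ X a.im = w ^ j := by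
  have h3 : ¬3 ∣ a.re := not_dvd_re hco him
  have h3' : ¬3 ∣ a.re + a.im := fun h ↦ h3 ((dvd_add_left him).1 h)
  obtain ⟨i, hi⟩ := exists_mod_nine (sq_emod_three h3)
  obtain ⟨s, hs⟩ := exists_mod_nine (sq_emod_three h3')
  have hN3 : ¬3 ∣ a.norm := by
    rw [norm_eq]
    intro h
    refine h3 ((Nat.prime_iff_prime_int.1 Nat.prime_three).dvd_of_dvd_pow (n := 2) ?_)
    have h1 := dvd_sub h (him.mul_right (a.im - a.re))
    have e : a.re ^ 2 = a.re ^ 2 - a.re * a.im + a.im ^ 2 - a.im * (a.im - a.re) := by ring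
    rw [e]
    exact h1
  obtain ⟨k, hk⟩ : ∃ k, a.norm.natAbs = 3 * k + 1 := by
    have := norm_emod_three him hN3
    have := norm_nonneg a
    exact ⟨a.norm.natAbs / 3, by omega⟩
  have hk' : a.norm = 3 * k + 1 := by
    have := norm_nonneg a
    omega
  have hXw : X w = w ^ k := by
    rw [hX.map_w, hk, Nat.add_sub_cancel, Nat.mul_div_cancel_left _ (by norm_num)]
  have hA := hX.map_re hco him hi
  have hAB := hX.map_re_add_im hco him hs
  have hw (n : ℕ) : (w ^ n) ^ 3 = 1 := by rw [← pow_mul, mul_comm, pow_mul, w_pow_three, one_pow]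
  have e1 : X (a.re + a.im : ℤ) = X a.re * X (1 - w ^ 2) := by
    rw [← map_mul]
    refine hX.congr _ _ ⟨w ^ 2, ?_⟩
    push_cast
    linear_combination -w ^ 2 * eq_re_add_im a - (a.im : EisensteinInt) * w_pow_three
  have e2 : X (1 - w ^ 2) ^ 2 = X 3 * X w ^ 2 := by
    rw [← map_pow, ← map_pow, ← map_mul, ← hX.map_neg]
    congr 1
  have e3 : X a.re = X a.im * X w := by
    rw [← map_mul, ← hX.map_neg (a.im * w)]
    refine hX.congr _ _ ⟨1, ?_⟩
    linear_combination -eq_re_add_im a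
  rw [hA, hAB, pow_mul'] at e1
  rw [hXw] at e2
  rw [hA, hXw] at e3
  have hB0 : X a.im = w ^ (i + 2 * k) := by
    rw [pow_add, pow_mul', e3]
    linear_combination -X a.im * hw k
  have h30 : X 3 = w ^ (s + i + k) := by
    have f1 : X (1 - w ^ 2) = (w ^ s) ^ 2 * (w ^ i) ^ 2 := by
      linear_combination -(w ^ i) ^ 2 * e1 - X (1 - w ^ 2) * hw i
    rw [f1] at e2
    rw [pow_add, pow_add]
    linear_combination -w ^ k * e2 - X 3 * hw k + w ^ k * (w ^ s * (w ^ i) ^ 4 * hw s +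
      w ^ s * w ^ i * hw i)
  obtain ⟨b, hb⟩ := him
  rw [norm_eq] at hk'
  obtain ⟨c, hc⟩ := Int.modEq_iff_dvd.1 hi
  obtain ⟨d, hd⟩ := Int.modEq_iff_dvd.1 hs
  rw [hb] at hj hd hk'
  rw [h30, hB0]
  constructor
  · refine w_pow_eq_of_modEq (Int.ModEq.trans (Int.modEq_iff_dvd.2 ?_) hj.symm)
    refine ⟨d - 2 * c - i - 2 * b ^ 2, ?_⟩
    push_cast
    linear_combination hd - 2 * hc + hk'
  · refine w_pow_eq_of_modEq (Int.ModEq.trans (Int.modEq_iff_dvd.2 ?_) hj.symm)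
    refine ⟨a.re * b - i - 2 * c - 2 * b ^ 2, ?_⟩
    push_cast
    linear_combination -2 * hc + 2 * hk'

end Primary

end IsCubicSymbol

end EisensteinInt

namespace EisensteinInt

open QuadraticAlgebra

/-! ### The cubic character of `x + y √-3` -/

section Character

variable {p : ℕ} [Fact p.Prime] {x y t δ : ℤ}

lemma exists_symbol_of_isCoprime {a : EisensteinInt} (hco : IsCoprime a.re a.im) (him : 3 ∣ a.im) :
    ∃ X, IsCubicSymbol a X := by
  obtain ⟨m, hm⟩ := exists_dvd_w_sub hco
  refine exists_isCubicSymbol a.norm.natAbs a (Int.natAbs_of_nonneg (norm_nonneg a)).symm him ?_ m hm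
  rw [norm_eq]
  intro h
  refine IsCubicSymbol.not_dvd_re hco him
    ((Nat.prime_iff_prime_int.1 Nat.prime_three).dvd_of_dvd_pow (n := 2) ?_)
  have h1 := dvd_sub h (him.mul_right (a.im - a.re))
  have e : a.re ^ 2 = a.re ^ 2 - a.re * a.im + a.im ^ 2 - a.im * (a.im - a.re) := by ring
  rw [e]
  exact h1

lemma exists_three_mul_modEq {c : ℤ} (h : 3 ∣ c) : ∃ j : ℕ, (3 * j : ℤ) ≡ c [ZMOD 9] :=
  ⟨(c % 9 / 3).toNat, by unfold Int.ModEq; omega⟩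

lemma IsCubicSymbol.map_sign {a : EisensteinInt} {X : EisensteinInt →* EisensteinInt}
    (hX : IsCubicSymbol a X) (hδ : δ = 1 ∨ δ = -1) : X δ = 1 := by
  rcases hδ with rfl | rfl
  · simp
  · simpa using hX.map_neg_one

lemma isCoprime_two_of_odd {z : ℤ} (h : Odd z) : IsCoprime z 2 := by
  obtain ⟨k, hk⟩ := h
  exact ⟨1, -k, by linarith⟩

variable (hp3 : p ≠ 3) (hco : IsCoprime x y) (hodd : Odd (x + y)) (hδ : δ = 1 ∨ δ = -1)
  (hp : (p : ℤ) = t * (x ^ 2 + 3 * y ^ 2) + 12 * δ * y ^ 2) (hpN : ¬(p : ℤ) ∣ x ^ 2 + 3 * y ^ 2)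
  (g : EisensteinInt →+* AlgebraicClosure (ZMod p))

include hp3 hco hodd hδ hp hpN

lemma pow_eq_of_three_dvd (h3 : 3 ∣ y) :
    (x + y * (1 + 2 * g w)) ^ ((p ^ 2 - 1) / 3) = (x - y * (1 + 2 * g w)) ^ ((p ^ 2 - 1) / 3) := by
  -- This is `x + yθ` with `θ = 1 + 2w`. Here `p ≡ 3δ a.im^2` mod `a`, whose symbol is the cube of a
  -- cube root of unity.
  set a : EisensteinInt := ⟨x + y, 2 * y⟩ with ha
  have him : 3 ∣ a.im := h3.mul_left 2
  have hco' : IsCoprime a.re a.im := by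
    refine IsCoprime.mul_right (isCoprime_two_of_odd hodd) ?_
    simpa using hco.add_mul_left_left 1
  have hnorm : a.norm = x ^ 2 + 3 * y ^ 2 := by rw [norm_eq, ha]; ring
  obtain ⟨X, hX⟩ := exists_symbol_of_isCoprime hco' him
  obtain ⟨j, hj⟩ := exists_three_mul_modEq (him.mul_left a.re)
  obtain ⟨hX3, hXB⟩ := hX.map_three_and_map_im hco' him hj
  have hXp : X p = 1 := by
    have h1 : X p = X (δ * (3 * (a.im : EisensteinInt) ^ 2)) := by
      refine hX.congr _ _ ⟨star a * t, ?_⟩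
      rw [← mul_assoc a, mul_star_eq_norm a, hnorm, show a.im = 2 * y from rfl]
      have := congrArg (Int.cast : ℤ → EisensteinInt) hp
      push_cast at this ⊢
      linear_combination this
    rw [h1, map_mul, map_mul, map_pow, hX.map_sign hδ, hX3, hXB, one_mul, ← pow_succ', pow_right_comm,
      w_pow_three, one_pow]
  have hr := hX.reciprocity p hp3 (hnorm ▸ hpN) g
  rw [hXp, map_one, one_pow, one_mul, map_eq, map_star] at hr
  have hw := map_w_sq_add g
  convert hr using 2
  · simp only [ha]
    push_cast
    ring
  · simp only [ha]
    push_cast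
    linear_combination -2 * (y : AlgebraicClosure (ZMod p)) * hw

lemma pow_eq_of_three_dvd_sub (h3 : 3 ∣ y - x) {e : ℕ}
    (he : (3 * e : ℤ) ≡ -4 * y * (x - y) + 4 * (4 * y ^ 2 - 1) + p ^ 2 - 1 [ZMOD 9]) :
    (x + y * (1 + 2 * g w)) ^ ((p ^ 2 - 1) / 3) =
      g w ^ e * (x - y * (1 + 2 * g w)) ^ ((p ^ 2 - 1) / 3) := by
  -- This is `w (x + yθ)`, the associate with imaginary part divisible by 3. Now `p ≡ 3δ a.re^2` mod
  -- `a`, and the unit `w` contributes the term `p^2 - 1` in the exponent.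
  set a : EisensteinInt := ⟨-2 * y, x - y⟩ with ha
  have him : 3 ∣ a.im := by rw [ha, ← neg_sub, dvd_neg]; exact h3
  have hco' : IsCoprime a.re a.im := by
    refine IsCoprime.mul_left ?_ ?_
    · rw [IsCoprime.neg_left_iff]
      refine (isCoprime_two_of_odd ?_).symm
      have : x - y = x + y - 2 * y := by ring
      change Odd (x - y)
      rw [this]
      exact hodd.sub_even (even_two_mul y)
    · have h := (hco.add_mul_left_left (-1)).symm
      have e : x + y * -1 = x - y := by ring
      rwa [e] at h
  have hnorm : a.norm = x ^ 2 + 3 * y ^ 2 := by rw [norm_eq, ha]; ring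
  obtain ⟨X, hX⟩ := exists_symbol_of_isCoprime hco' him
  obtain ⟨j, hj⟩ := exists_three_mul_modEq (him.mul_left a.re)
  have h3A := IsCubicSymbol.not_dvd_re hco' him
  obtain ⟨i, hi⟩ := exists_mod_nine (sq_emod_three h3A)
  obtain ⟨hX3, -⟩ := hX.map_three_and_map_im hco' him hj
  have hXA := hX.map_re hco' him hi
  have hXp : X p = w ^ (j + 2 * i) := by
    have h1 : X p = X (δ * (3 * (a.re : EisensteinInt) ^ 2)) := by
      refine hX.congr _ _ ⟨star a * t, ?_⟩
      rw [← mul_assoc a, mul_star_eq_norm a, hnorm, show a.re = -2 * y from rfl]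
      have := congrArg (Int.cast : ℤ → EisensteinInt) hp
      push_cast at this ⊢
      linear_combination this
    rw [h1, map_mul, map_mul, map_pow, hX.map_sign hδ, hX3, hXA, one_mul, pow_add, pow_mul']
  have hr := hX.reciprocity p hp3 (hnorm ▸ hpN) g
  have hw := map_w_sq_add g
  have hw3 := map_w_pow_three g
  have hn3 : ((3 * ((p ^ 2 - 1) / 3 : ℕ) : ℕ) : ℤ) = p ^ 2 - 1 := by
    have h0 : ¬3 ∣ (p : ℤ) := fun h ↦
      hp3 ((Nat.prime_dvd_prime_iff_eq Nat.prime_three Fact.out).1 (by exact_mod_cast h)).symm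
    have h1 := sq_emod_three h0
    have h2 : p ^ 2 % 3 = 1 := by exact_mod_cast h1
    have h4 : 3 * ((p ^ 2 - 1) / 3) + 1 = p ^ 2 := by omega
    have h5 := congrArg (Nat.cast : ℕ → ℤ) h4
    push_cast at h5 ⊢
    linarith
  have e1 : g a = g w * (x + y * (1 + 2 * g w)) := by
    rw [map_eq, ha]
    push_cast
    linear_combination -2 * (y : AlgebraicClosure (ZMod p)) * hw
  have e2 : g (star a) = g w ^ 2 * (x - y * (1 + 2 * g w)) := by
    rw [map_star, ha]
    push_cast
    linear_combination 2 * (y : AlgebraicClosure (ZMod p)) * hw3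
  have hexp : w ^ e = w ^ (2 * (j + 2 * i) + (p ^ 2 - 1) / 3) := by
    refine w_pow_eq_of_modEq (he.trans ?_)
    obtain ⟨c, hc⟩ := Int.modEq_iff_dvd.1 hi
    obtain ⟨d, hd⟩ := Int.modEq_iff_dvd.1 hj
    rw [ha] at hc hd
    refine Int.modEq_iff_dvd.2 ⟨-2 * d - 4 * c, ?_⟩
    push_cast at hn3 hc hd ⊢
    linear_combination -2 * hd - 4 * hc + hn3
  rw [hXp, e1, e2, mul_pow, mul_pow] at hr
  rw [← map_pow, hexp]
  generalize (p ^ 2 - 1) / 3 = n at hr ⊢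
  rw [map_pow] at hr ⊢
  have hw0 : g w ^ n ≠ 0 := pow_ne_zero _ fun h ↦ by simp [h] at hw3
  refine mul_left_cancel₀ hw0 ?_
  rw [hr]
  ring

end Character

/-! ### Powers of the golden ratio -/

section Golden

variable {p : ℕ} {K : Type*} [Field K] {u v ψ : K}

/-- For `p = 6k + 1` put `A = u^(2k)`, `B = v^(2k)`. Then `A^3 = 1`, `AB = 1`, and the hypothesis
reads `A^2 = ψ B^2`, whence `A = ψ`. -/
lemma morganVoyce_of_pow_self (hp1 : p % 6 = 1) (h : u + v = 1) (h' : u * v = -1) (hu : u ^ p = u)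
    (hv : v ^ p = v) (hψ : ψ ^ 3 = 1) (hn : u ^ ((p ^ 2 - 1) / 3) = ψ * v ^ ((p ^ 2 - 1) / 3)) :
    morganVoyce (1 : K) (p / 3) * (u - v) = ψ ^ 2 * u - ψ * v := by
  obtain ⟨k, rfl⟩ : ∃ k, p = 6 * k + 1 := ⟨p / 6, by omega⟩
  have hu0 : u ≠ 0 := by rintro rfl; simp at h'
  have hv0 : v ≠ 0 := by rintro rfl; simp at h'
  have e1 : ((6 * k + 1) ^ 2 - 1) / 3 = (6 * k + 2) * (2 * k) := by
    rw [show (6 * k + 1) ^ 2 - 1 = 3 * ((6 * k + 2) * (2 * k)) by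
      rw [Nat.sub_eq_iff_eq_add (Nat.one_le_pow _ _ (by omega))]; ring, Nat.mul_div_cancel_left _ (by norm_num)]
  have e2 : (6 * k + 1) / 3 = 2 * k := by omega
  have hu2 : u ^ (6 * k + 2) = u ^ 2 := by rw [pow_succ, hu, pow_two]
  have hv2 : v ^ (6 * k + 2) = v ^ 2 := by rw [pow_succ, hv, pow_two]
  rw [e1, pow_mul u (6 * k + 2), pow_mul v (6 * k + 2), hu2, hv2] at hn
  rw [e2, morganVoyce_one_mul_sub h h', pow_succ, pow_succ, pow_mul', pow_mul' v]
  rw [pow_right_comm u, pow_right_comm v] at hn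
  have hA3 : (u ^ (2 * k)) ^ 3 = 1 := by
    refine mul_right_cancel₀ hu0 ?_
    rw [← pow_mul, ← pow_succ, show 2 * k * 3 + 1 = 6 * k + 1 by ring, hu, one_mul]
  have hAB : u ^ (2 * k) * v ^ (2 * k) = 1 := by rw [← mul_pow, h', pow_mul]; simp
  generalize u ^ (2 * k) = A at *
  generalize v ^ (2 * k) = B at *
  have hA : A = ψ := by
    linear_combination -A * hA3 + A ^ 2 * hn + ψ * (A * B + 1) * hAB
  have hB : B = ψ ^ 2 := by
    rw [hA] at hAB
    linear_combination ψ ^ 2 * hAB - B * hψ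
  rw [hA, hB]
  linear_combination -v * ψ * hψ

/-- For `p = 6k + 5` put `A = u^(2k+2)`, `B = v^(2k+2)`. Then `A^3 = uv = -1`, `AB = 1`, and the
hypothesis becomes `B^2 = ψ A^2`, whence `A = -ψ^2`. -/
lemma morganVoyce_of_pow_conj (hp5 : p % 6 = 5) (h : u + v = 1) (h' : u * v = -1) (hu : u ^ p = v)
    (hv : v ^ p = u) (hψ : ψ ^ 3 = 1) (hn : u ^ ((p ^ 2 - 1) / 3) = ψ * v ^ ((p ^ 2 - 1) / 3)) :
    morganVoyce (1 : K) (p / 3) * (u - v) = ψ ^ 2 * u - ψ * v := by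
  obtain ⟨k, rfl⟩ : ∃ k, p = 6 * k + 5 := ⟨p / 6, by omega⟩
  have hu0 : u ≠ 0 := by rintro rfl; simp at h'
  have hv0 : v ≠ 0 := by rintro rfl; simp at h'
  have e1 : ((6 * k + 5) ^ 2 - 1) / 3 = (6 * k + 4) * (2 * k + 2) := by
    rw [show (6 * k + 5) ^ 2 - 1 = 3 * ((6 * k + 4) * (2 * k + 2)) by
      rw [Nat.sub_eq_iff_eq_add (Nat.one_le_pow _ _ (by omega))]; ring, Nat.mul_div_cancel_left _ (by norm_num)]
  have e2 : (6 * k + 5) / 3 = 2 * k + 1 := by omega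
  have hu' : u ^ (6 * k + 4) * u = v := by rw [← pow_succ, hu]
  have hv' : v ^ (6 * k + 4) * v = u := by rw [← pow_succ, hv]
  have hA3 : (u ^ (2 * k + 2)) ^ 3 = -1 := by
    rw [← pow_mul, show (2 * k + 2) * 3 = 6 * k + 5 + 1 by ring, pow_succ, hu, mul_comm, h']
  have hAB : u ^ (2 * k + 2) * v ^ (2 * k + 2) = 1 := by
    rw [← mul_pow, h', show 2 * k + 2 = 2 * (k + 1) by ring, pow_mul]; simp
  have hn2 : (v ^ (2 * k + 2)) ^ 2 = ψ * (u ^ (2 * k + 2)) ^ 2 := by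
    have h1 := congrArg (fun z ↦ z * (u ^ (2 * k + 2) * v ^ (2 * k + 2))) hn
    simp only [e1, pow_mul _ (6 * k + 4)] at h1
    calc (v ^ (2 * k + 2)) ^ 2 = (u ^ (6 * k + 4) * u) ^ (2 * k + 2) * v ^ (2 * k + 2) := by
          rw [hu', pow_two]
      _ = (u ^ (6 * k + 4)) ^ (2 * k + 2) * (u ^ (2 * k + 2) * v ^ (2 * k + 2)) := by
          rw [mul_pow]; ring
      _ = ψ * ((v ^ (6 * k + 4) * v) ^ (2 * k + 2) * u ^ (2 * k + 2)) := by
          rw [h1, mul_pow]; ring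
      _ = _ := by rw [hv', pow_two]
  have hU : u ^ (2 * (2 * k + 1) + 1) = -((u ^ (2 * k + 2)) ^ 2 * v) := by
    rw [← pow_mul, show (2 * k + 2) * 2 = 2 * (2 * k + 1) + 1 + 1 by ring, pow_succ _ (2 * (2 * k + 1) + 1),
      mul_assoc, h']
    ring
  have hV : v ^ (2 * (2 * k + 1) + 1) = -((v ^ (2 * k + 2)) ^ 2 * u) := by
    rw [← pow_mul, show (2 * k + 2) * 2 = 2 * (2 * k + 1) + 1 + 1 by ring, pow_succ _ (2 * (2 * k + 1) + 1),
      mul_assoc, mul_comm v, h']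
    ring
  rw [e2, morganVoyce_one_mul_sub h h', hU, hV]
  generalize u ^ (2 * k + 2) = A at *
  generalize v ^ (2 * k + 2) = B at *
  have hA1 : ψ * A = -1 := by
    linear_combination A ^ 2 * hn2 - (A * B + 1) * hAB + ψ * A * hA3
  have hA : A = -ψ ^ 2 := by linear_combination ψ ^ 2 * hA1 - A * hψ
  have hB : B = -ψ := by linear_combination B * hA1 - ψ * hAB
  rw [hA, hB]
  linear_combination -v * ψ * hψ

end Golden

end EisensteinInt

/-! ### Evaluation of the truncated sums -/

lemma map_morganVoyce {R S : Type*} [CommRing R] [CommRing S] (f : R →+* S) (t : R) (n : ℕ) :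
    f (morganVoyce t n) = morganVoyce (f t) n := by
  simp [morganVoyce]

/-! ### Divisibility and congruences for the representations of `p` -/

section Arithmetic

variable {p : ℕ} {x y α β t δ : ℤ}

lemma isCoprime_of_prime_eq (hp : p.Prime) (h : (p : ℤ) = α * x ^ 2 + β * y ^ 2) :
    IsCoprime x y := by
  rw [Int.isCoprime_iff_gcd_eq_one]
  obtain ⟨a, ha⟩ := Int.gcd_dvd_left x y
  obtain ⟨b, hb⟩ := Int.gcd_dvd_right x y
  generalize x.gcd y = d at ha hb ⊢
  have h1 : (d : ℤ) * d ∣ p := ⟨α * a ^ 2 + β * b ^ 2, by rw [h, ha, hb]; ring⟩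
  have h2 : d * d ∣ p := by exact_mod_cast h1
  exact Nat.isUnit_iff.1 (hp.prime.squarefree d h2)

lemma not_dvd_right (hp : p.Prime) (hα : ¬(p : ℤ) ∣ α) (h : (p : ℤ) = α * x ^ 2 + β * y ^ 2) :
    ¬(p : ℤ) ∣ y := by
  intro hy
  have hpZ := Nat.prime_iff_prime_int.1 hp
  have h1 : (p : ℤ) ∣ α * x ^ 2 := by
    have h2 := dvd_sub (dvd_refl (p : ℤ)) ((dvd_pow hy two_ne_zero).mul_left β)
    have e : α * x ^ 2 = p - β * y ^ 2 := by rw [h]; ring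
    rwa [e]
  have hx := hpZ.dvd_of_dvd_pow ((hpZ.dvd_or_dvd h1).resolve_left hα)
  exact hpZ.not_isUnit ((isCoprime_of_prime_eq hp h).isUnit_of_dvd' hx hy)

lemma not_intCast_dvd_of_lt {m : ℤ} (h0 : 0 < m) (h : m < p) : ¬(p : ℤ) ∣ m := fun h' ↦ by
  have := Int.le_of_dvd h0 h'
  omega

lemma not_dvd_sq_add (hp : p.Prime) (hp5 : 5 < p) (hδ : δ = 1 ∨ δ = -1) (hy : ¬(p : ℤ) ∣ y)
    (h : (p : ℤ) = t * (x ^ 2 + 3 * y ^ 2) + 12 * δ * y ^ 2) : ¬(p : ℤ) ∣ x ^ 2 + 3 * y ^ 2 := by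
  intro hN
  have hpZ := Nat.prime_iff_prime_int.1 hp
  have h1 : (p : ℤ) ∣ 2 * (2 * (3 * y ^ 2)) := by
    have h2 := (dvd_sub (dvd_refl (p : ℤ)) (hN.mul_left t)).mul_left δ
    have hδ2 : δ * δ = 1 := by rcases hδ with rfl | rfl <;> norm_num
    have e : 2 * (2 * (3 * y ^ 2)) = δ * (p - t * (x ^ 2 + 3 * y ^ 2)) := by
      rw [h]; linear_combination -12 * y ^ 2 * hδ2
    rwa [e]
  have n2 : ¬(p : ℤ) ∣ 2 := not_intCast_dvd_of_lt (by norm_num) (by omega)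
  have n3 : ¬(p : ℤ) ∣ 3 := not_intCast_dvd_of_lt (by norm_num) (by omega)
  have h2 := (hpZ.dvd_or_dvd h1).resolve_left n2
  have h3 := (hpZ.dvd_or_dvd h2).resolve_left n2
  exact hy (hpZ.dvd_of_dvd_pow ((hpZ.dvd_or_dvd h3).resolve_left n3))

lemma not_three_dvd_of_dvd_sub (hp : p.Prime)
    (h : (p : ℤ) = α * x ^ 2 + β * y ^ 2) (h3 : 3 ∣ y - x) : ¬3 ∣ y := by
  intro hy
  have hx : 3 ∣ x := by
    have := dvd_sub hy h3
    rwa [sub_sub_cancel] at this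
  exact (Nat.prime_iff_prime_int.1 Nat.prime_three).not_isUnit
    ((isCoprime_of_prime_eq hp h).isUnit_of_dvd' hx hy)

lemma three_mul_eq_zero_zmod_nine {z : ℤ} : 3 * (z : ZMod 9) = 0 ↔ 3 ∣ z := by
  have : ((3 * z : ℤ) : ZMod 9) = 0 ↔ (9 : ℤ) ∣ 3 * z :=
    ZMod.intCast_zmod_eq_zero_iff_dvd (3 * z) 9
  push_cast at this
  rw [this]
  omega

lemma modEq_nine_of_add_fifteen (h : (p : ℤ) = x ^ 2 + 15 * y ^ 2) (h3 : 3 ∣ y - x) (hy : ¬3 ∣ y) :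
    (3 * (2 : ℕ) : ℤ) ≡ -4 * y * (x - y) + 4 * (4 * y ^ 2 - 1) + p ^ 2 - 1 [ZMOD 9] := by
  -- Multiplying by 3 expresses divisibility by 3 inside `ZMod 9`, leaving a finite check.
  have key : ∀ x y : ZMod 9, 3 * (y - x) = 0 → 3 * y ≠ 0 →
      3 * 2 = -4 * y * (x - y) + 4 * (4 * y ^ 2 - 1) + (x ^ 2 + 15 * y ^ 2) ^ 2 - 1 := by decide
  rw [h]
  refine (ZMod.intCast_eq_intCast_iff _ _ 9).1 ?_
  push_cast
  refine key x y ?_ (three_mul_eq_zero_zmod_nine.not.2 hy)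
  have := three_mul_eq_zero_zmod_nine.2 h3
  push_cast at this
  exact this

lemma modEq_nine_of_five_add_three (h : (p : ℤ) = 5 * x ^ 2 + 3 * y ^ 2) (h3 : 3 ∣ y - x)
    (hy : ¬3 ∣ y) :
    (3 * (1 : ℕ) : ℤ) ≡ -4 * y * (x - y) + 4 * (4 * y ^ 2 - 1) + p ^ 2 - 1 [ZMOD 9] := by
  have key : ∀ x y : ZMod 9, 3 * (y - x) = 0 → 3 * y ≠ 0 →
      3 * 1 = -4 * y * (x - y) + 4 * (4 * y ^ 2 - 1) + (5 * x ^ 2 + 3 * y ^ 2) ^ 2 - 1 := by decide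
  rw [h]
  refine (ZMod.intCast_eq_intCast_iff _ _ 9).1 ?_
  push_cast
  refine key x y ?_ (three_mul_eq_zero_zmod_nine.not.2 hy)
  have := three_mul_eq_zero_zmod_nine.2 h3
  push_cast at this
  exact this

end Arithmetic

/-! ### The Fibonacci sum for each of the two forms -/

section Evaluation

open EisensteinInt

variable {p : ℕ} [Fact p.Prime] {x y : ℤ}

lemma intCast_pow_self (z : ℤ) :
    (z : AlgebraicClosure (ZMod p)) ^ p = z := by
  rw [← frobenius_def, map_intCast]

lemma natCast_ne_zero_of_lt {m : ℕ} (h0 : 0 < m) (h : m < p) :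
    (m : AlgebraicClosure (ZMod p)) ≠ 0 := fun h' ↦
  Nat.not_dvd_of_pos_of_lt h0 h ((CharP.cast_eq_zero_iff _ p _).1 h')

lemma even_sq_sub_one_div_three (hp5 : 5 < p) : Even ((p ^ 2 - 1) / 3) := by
  have hp := Fact.out (p := p.Prime)
  have h2 : p % 2 = 1 := hp.eq_two_or_odd.resolve_left (by omega)
  have h3 : p % 3 ≠ 0 := fun h ↦ by
    have := (Nat.prime_dvd_prime_iff_eq Nat.prime_three hp).1 (Nat.dvd_of_mod_eq_zero h)
    omega
  have h4 : p ^ 2 % 4 = 1 := by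
    rcases (by omega : p % 4 = 1 ∨ p % 4 = 3) with h | h <;> simp [Nat.pow_mod, h]
  have h5 : p ^ 2 % 3 = 1 := by
    rcases (by omega : p % 3 = 1 ∨ p % 3 = 2) with h | h <;> simp [Nat.pow_mod, h]
  rw [Nat.even_iff]
  omega

lemma morganVoyce_of_add_fifteen (hp5 : 5 < p) (hp1 : p % 3 = 1)
    (h : (p : ℤ) = x ^ 2 + 15 * y ^ 2) :
    (3 ∣ y → morganVoyce (1 : ZMod p) (p / 3) = 1) ∧
    (3 ∣ y - x → morganVoyce (1 : ZMod p) (p / 3) * (10 * y) = x - 5 * y) := by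
  have hp := Fact.out (p := p.Prime)
  have h2 : p % 2 = 1 := hp.eq_two_or_odd.resolve_left (by omega)
  have hform : (p : ℤ) = 1 * x ^ 2 + 15 * y ^ 2 := by rw [h]; ring
  have hrep : (p : ℤ) = 1 * (x ^ 2 + 3 * y ^ 2) + 12 * 1 * y ^ 2 := by rw [h]; ring
  have hco := isCoprime_of_prime_eq hp hform
  have hy := not_dvd_right hp (not_intCast_dvd_of_lt (by norm_num) (by omega)) hform
  have hN := not_dvd_sq_add hp hp5 (Or.inl rfl) hy hrep
  have hodd : Odd (x + y) := by
    by_contra hev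
    obtain ⟨k, hk⟩ := Int.not_odd_iff_even.1 hev
    have : (p : ℤ) = 2 * (2 * k ^ 2 - 2 * k * y + 8 * y ^ 2) := by
      rw [h, show x = k + k - y by linarith]; ring
    omega
  obtain ⟨g⟩ := exists_hom_algebraicClosure (l := p) (by omega)
  have hgw := map_w_sq_add g
  have hgw3 := map_w_pow_three g
  have h30 : (3 : AlgebraicClosure (ZMod p)) ≠ 0 := by
    exact_mod_cast natCast_ne_zero_of_lt (p := p) (m := 3) (by norm_num) (by omega)
  have h20 : (2 : AlgebraicClosure (ZMod p)) ≠ 0 := by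
    exact_mod_cast natCast_ne_zero_of_lt (p := p) (m := 2) (by norm_num) (by omega)
  have h50 : (5 : AlgebraicClosure (ZMod p)) ≠ 0 := by
    exact_mod_cast natCast_ne_zero_of_lt (p := p) (m := 5) (by norm_num) (by omega)
  have hy0 : (y : AlgebraicClosure (ZMod p)) ≠ 0 := fun h' ↦
    hy ((CharP.intCast_eq_zero_iff _ p _).1 h')
  have hp0 : (x : AlgebraicClosure (ZMod p)) ^ 2 + 15 * y ^ 2 = 0 := by
    have := congrArg (Int.cast : ℤ → AlgebraicClosure (ZMod p)) h
    push_cast at this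
    rw [← this, CharP.cast_eq_zero]
  have hwp : g w ^ p = g w := by
    rw [pow_eq_pow_mod p hgw3, hp1, pow_one]
  have h1 := pow_eq_of_three_dvd (by omega) hco hodd (Or.inl rfl) hrep hN g
  have h2' := fun h3 ↦ pow_eq_of_three_dvd_sub (by omega) hco hodd (Or.inl rfl) hrep hN g h3
    (modEq_nine_of_add_fifteen h h3 (not_three_dvd_of_dvd_sub hp hform h3))
  set θ := 1 + 2 * g w with hθ
  have hθ2 : θ ^ 2 = -3 := by rw [hθ]; linear_combination 4 * hgw
  have hθ0 : θ ≠ 0 := fun h' ↦ h30 (by rw [h'] at hθ2; linear_combination hθ2)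
  -- A square root of 5, since `x^2 = -15y^2` and `θ^2 = -3`. Frobenius fixes it because `p ≡ 1` mod
  -- 3.
  set r : AlgebraicClosure (ZMod p) := x / (y * θ) with hr
  have hrθ : r * (y * θ) = x := div_mul_cancel₀ _ (mul_ne_zero hy0 hθ0)
  have hr2 : r ^ 2 = 5 := by
    refine mul_right_cancel₀ (mul_ne_zero h30 (pow_ne_zero 2 hy0)) ?_
    linear_combination -(r * (y * θ) + x) * hrθ - hp0 + r ^ 2 * y ^ 2 * hθ2
  have hr0 : r ≠ 0 := fun h' ↦ h50 (by rw [← hr2, h']; ring)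
  have hθp : θ ^ p = θ := by
    have : frobenius _ p θ = θ := by
      rw [hθ, map_add, map_mul, map_one, map_ofNat, frobenius_def, hwp]
    exact this
  have hrp : r ^ p = r := by
    rw [hr, div_pow, mul_pow, intCast_pow_self, intCast_pow_self, hθp]
  have hfrob : ∀ s : AlgebraicClosure (ZMod p), s ^ p = s → ((1 + s) / 2) ^ p = (1 + s) / 2 := by
    intro s hs
    have : frobenius _ p ((1 + s) / 2) = (1 + s) / 2 := by
      rw [map_div₀, map_add, map_one, map_ofNat, frobenius_def, hs]
    exact this
  have hu := hfrob r hrp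
  have hv := hfrob (-r) (by rw [Odd.neg_pow (Nat.odd_iff.2 h2), hrp])
  have huv : (1 + r) / 2 + (1 + -r) / 2 = 1 := by field_simp; ring
  have huv' : (1 + r) / 2 * ((1 + -r) / 2) = -1 := by
    field_simp
    linear_combination -hr2
  have hxu : (1 + r) / 2 = (x + y * θ) / (2 * (y * θ)) := by
    field_simp
    linear_combination hrθ
  have hxv : (1 + -r) / 2 = -((x - y * θ) / (2 * (y * θ))) := by
    field_simp
    linear_combination -hrθ
  have hmain : ∀ ψ : AlgebraicClosure (ZMod p), ψ ^ 3 = 1 →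
      (x + y * θ) ^ ((p ^ 2 - 1) / 3) = ψ * (x - y * θ) ^ ((p ^ 2 - 1) / 3) →
      morganVoyce (1 : AlgebraicClosure (ZMod p)) (p / 3) * r =
        ψ ^ 2 * ((1 + r) / 2) - ψ * ((1 + -r) / 2) := by
    intro ψ hψ hpow
    rw [← morganVoyce_of_pow_self (by omega) huv huv' hu hv hψ]
    · field_simp; ring
    -- The minus sign in `hxv` is lost because the exponent is even.
    · rw [hxu, hxv, (even_sq_sub_one_div_three hp5).neg_pow, div_pow, div_pow, hpow, mul_div_assoc]
  have hinj := (algebraMap (ZMod p) (AlgebraicClosure (ZMod p))).injective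
  refine ⟨fun h3 ↦ hinj ?_, fun h3 ↦ hinj ?_⟩
  · have := hmain 1 (one_pow 3) (by rw [one_mul]; exact h1 h3)
    rw [map_morganVoyce, map_one]
    refine mul_right_cancel₀ hr0 ?_
    rw [this]
    field_simp
    ring
  · have := hmain (g w ^ 2) (by rw [pow_right_comm, hgw3, one_pow]) (h2' h3)
    rw [map_mul, map_morganVoyce, map_one]
    simp only [map_mul, map_sub, map_intCast, map_ofNat]
    have e : 2 * (morganVoyce (1 : AlgebraicClosure (ZMod p)) (p / 3) * r) = θ - r := by
      rw [this, hθ]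
      field_simp
      linear_combination (g w * (1 + r)) * hgw3 - (1 - r) * hgw
    generalize morganVoyce (1 : AlgebraicClosure (ZMod p)) (p / 3) = M at e ⊢
    refine mul_right_cancel₀ hr0 ?_
    linear_combination 5 * y * e + r * hrθ - y * θ * hr2

lemma morganVoyce_of_five_add_three (hp5 : 5 < p) (hp2 : p % 3 = 2)
    (h : (p : ℤ) = 5 * x ^ 2 + 3 * y ^ 2) :
    (3 ∣ y → morganVoyce (1 : ZMod p) (p / 3) = 1) ∧
    (3 ∣ y - x → morganVoyce (1 : ZMod p) (p / 3) * (2 * y) = -(x + y)) := by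
  have hp := Fact.out (p := p.Prime)
  have h2 : p % 2 = 1 := hp.eq_two_or_odd.resolve_left (by omega)
  have hrep : (p : ℤ) = 5 * (x ^ 2 + 3 * y ^ 2) + 12 * -1 * y ^ 2 := by rw [h]; ring
  have hco := isCoprime_of_prime_eq hp h
  have hy := not_dvd_right hp (not_intCast_dvd_of_lt (by norm_num) (by omega)) h
  have hx := not_dvd_right hp (not_intCast_dvd_of_lt (by norm_num) (by omega)) ((add_comm _ _).trans h.symm).symm
  have hN := not_dvd_sq_add hp hp5 (Or.inr rfl) hy hrep
  have hodd : Odd (x + y) := by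
    by_contra hev
    obtain ⟨k, hk⟩ := Int.not_odd_iff_even.1 hev
    have : (p : ℤ) = 2 * (10 * k ^ 2 - 10 * k * y + 4 * y ^ 2) := by
      rw [h, show x = k + k - y by linarith]; ring
    omega
  obtain ⟨g⟩ := exists_hom_algebraicClosure (l := p) (by omega)
  have hgw := map_w_sq_add g
  have hgw3 := map_w_pow_three g
  have h30 : (3 : AlgebraicClosure (ZMod p)) ≠ 0 := by
    exact_mod_cast natCast_ne_zero_of_lt (p := p) (m := 3) (by norm_num) (by omega)
  have h20 : (2 : AlgebraicClosure (ZMod p)) ≠ 0 := by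
    exact_mod_cast natCast_ne_zero_of_lt (p := p) (m := 2) (by norm_num) (by omega)
  have h50 : (5 : AlgebraicClosure (ZMod p)) ≠ 0 := by
    exact_mod_cast natCast_ne_zero_of_lt (p := p) (m := 5) (by norm_num) (by omega)
  have hx0 : (x : AlgebraicClosure (ZMod p)) ≠ 0 := fun h' ↦
    hx ((CharP.intCast_eq_zero_iff _ p _).1 h')
  have hp0 : 5 * (x : AlgebraicClosure (ZMod p)) ^ 2 + 3 * y ^ 2 = 0 := by
    have := congrArg (Int.cast : ℤ → AlgebraicClosure (ZMod p)) h
    push_cast at this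
    rw [← this, CharP.cast_eq_zero]
  have hwp : g w ^ p = g w ^ 2 := by
    rw [pow_eq_pow_mod p hgw3, hp2]
  have h1 := pow_eq_of_three_dvd (by omega) hco hodd (Or.inr rfl) hrep hN g
  have h2' := fun h3 ↦ pow_eq_of_three_dvd_sub (by omega) hco hodd (Or.inr rfl) hrep hN g h3
    (modEq_nine_of_five_add_three h h3 (not_three_dvd_of_dvd_sub hp h h3))
  set θ := 1 + 2 * g w with hθ
  have hθ2 : θ ^ 2 = -3 := by rw [hθ]; linear_combination 4 * hgw
  -- Again `r^2 = 5`, now from `5x^2 = -3y^2`. As `p ≡ 2` mod 3, Frobenius negates `θ`, hence `r`,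
  -- and so swaps the two roots.
  set r : AlgebraicClosure (ZMod p) := y * θ / x with hr
  have hrθ : r * x = y * θ := div_mul_cancel₀ _ hx0
  have hr2 : r ^ 2 = 5 := by
    refine mul_right_cancel₀ (pow_ne_zero 2 hx0) ?_
    linear_combination (r * x + y * θ) * hrθ + y ^ 2 * hθ2 - hp0
  have hr0 : r ≠ 0 := fun h' ↦ h50 (by rw [← hr2, h']; ring)
  have hθp : θ ^ p = -θ := by
    have : frobenius _ p θ = -θ := by
      rw [hθ, map_add, map_mul, map_one, map_ofNat, frobenius_def, hwp]
      linear_combination 2 * hgw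
    exact this
  have hrp : r ^ p = -r := by
    rw [hr, div_pow, mul_pow, intCast_pow_self, intCast_pow_self, hθp]
    ring
  have hfrob : ∀ s : AlgebraicClosure (ZMod p), s ^ p = -s → ((1 + s) / 2) ^ p = (1 + -s) / 2 := by
    intro s hs
    have : frobenius _ p ((1 + s) / 2) = (1 + -s) / 2 := by
      rw [map_div₀, map_add, map_one, map_ofNat, frobenius_def, hs]
    exact this
  have hu := hfrob r hrp
  have hv := hfrob (-r) (by rw [Odd.neg_pow (Nat.odd_iff.2 h2), hrp])
  rw [neg_neg] at hv
  have huv : (1 + r) / 2 + (1 + -r) / 2 = 1 := by field_simp; ring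
  have huv' : (1 + r) / 2 * ((1 + -r) / 2) = -1 := by
    field_simp
    linear_combination -hr2
  have hxu : (1 + r) / 2 = (x + y * θ) / (2 * x) := by
    field_simp
    linear_combination hrθ
  have hxv : (1 + -r) / 2 = (x - y * θ) / (2 * x) := by
    field_simp
    linear_combination -hrθ
  have hmain : ∀ ψ : AlgebraicClosure (ZMod p), ψ ^ 3 = 1 →
      (x + y * θ) ^ ((p ^ 2 - 1) / 3) = ψ * (x - y * θ) ^ ((p ^ 2 - 1) / 3) →
      morganVoyce (1 : AlgebraicClosure (ZMod p)) (p / 3) * r =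
        ψ ^ 2 * ((1 + r) / 2) - ψ * ((1 + -r) / 2) := by
    intro ψ hψ hpow
    rw [← morganVoyce_of_pow_conj (by omega) huv huv' hu hv hψ]
    · field_simp; ring
    · rw [hxu, hxv, div_pow, div_pow, hpow, mul_div_assoc]
  have hinj := (algebraMap (ZMod p) (AlgebraicClosure (ZMod p))).injective
  refine ⟨fun h3 ↦ hinj ?_, fun h3 ↦ hinj ?_⟩
  · have := hmain 1 (one_pow 3) (by rw [one_mul]; exact h1 h3)
    rw [map_morganVoyce, map_one]
    refine mul_right_cancel₀ hr0 ?_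
    rw [this]
    field_simp
    ring
  · have := hmain (g w ^ 1) (by rw [pow_one, hgw3]) (h2' h3)
    rw [map_mul, map_morganVoyce, map_one]
    simp only [map_mul, map_neg, map_add, map_intCast, map_ofNat]
    have e : 2 * (morganVoyce (1 : AlgebraicClosure (ZMod p)) (p / 3) * r) = -θ - r := by
      rw [this, hθ]
      field_simp
      linear_combination (1 + r) * hgw
    generalize morganVoyce (1 : AlgebraicClosure (ZMod p)) (p / 3) = M at e ⊢
    refine mul_right_cancel₀ hr0 ?_
    linear_combination y * e + hrθ

end Evaluation

theorem theorem3p4 (p : ℕ) (hp : p.Prime) (hp5 : 5 < p) :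
    ((p % 15 = 1 ∨ p % 15 = 4) →
      RatModEq p (2 * sexticSum p - epsNine p) (cubicSum p) ∧
      (∃ x y : ℤ, (p : ℤ) = x ^ 2 + 15 * y ^ 2) ∧
      ∀ x y : ℤ, (p : ℤ) = x ^ 2 + 15 * y ^ 2 →
        ((3 ∣ y → RatModEq p (cubicSum p) 1) ∧
         (3 ∣ y - x → RatModEq p (cubicSum p) (((x : ℚ) - 5 * y) / (10 * y))))) ∧
    ((p % 15 = 2 ∨ p % 15 = 8) →
      RatModEq p (2 * sexticSum p - epsNine p) (cubicSum p) ∧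
      (∃ x y : ℤ, (p : ℤ) = 5 * x ^ 2 + 3 * y ^ 2) ∧
      ∀ x y : ℤ, (p : ℤ) = 5 * x ^ 2 + 3 * y ^ 2 →
        ((3 ∣ y → RatModEq p (cubicSum p) 1) ∧
         (3 ∣ y - x → RatModEq p (cubicSum p) (-((x : ℚ) + y) / (2 * y))))) := by
  have := Fact.mk hp
  have hpZ := Nat.prime_iff_prime_int.1 hp
  have hS := cubicSum_reducesTo (p := p) (by omega)
  have hT := sexticSum_reducesTo hp5
  have hone : ReducesTo p 1 1 := by simpa using ReducesTo.intCast (p := p) 1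
  refine ⟨fun hmod ↦ ⟨hT.ratModEq hS, exists_sq_add_fifteen_mul_sq hp5 hmod, fun x y hxy ↦ ?_⟩,
    fun hmod ↦ ⟨hT.ratModEq hS, exists_five_mul_sq_add_three_mul_sq hp5 hmod, fun x y hxy ↦ ?_⟩⟩
  · obtain ⟨h1, h2⟩ := morganVoyce_of_add_fifteen hp5 (by omega) hxy
    refine ⟨fun h3 ↦ hS.ratModEq (by rwa [h1 h3]), fun h3 ↦ hS.ratModEq ?_⟩
    have hy := not_dvd_right (α := 1) (x := x) (y := y) (β := 15) hp (not_intCast_dvd_of_lt (by norm_num) (by omega))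
      (by rw [hxy]; ring)
    have hd : ((10 * y : ℤ) : ZMod p) ≠ 0 := by
      rw [Ne, ZMod.intCast_zmod_eq_zero_iff_dvd, show 10 * y = 2 * (5 * y) by ring]
      intro h
      have h := (hpZ.dvd_or_dvd h).resolve_left (not_intCast_dvd_of_lt (by norm_num) (by omega))
      exact hy ((hpZ.dvd_or_dvd h).resolve_left (not_intCast_dvd_of_lt (by norm_num) (by omega)))
    have h := (ReducesTo.intCast (p := p) (x - 5 * y)).div_intCast hd
    push_cast at h hd
    rwa [← h2 h3, mul_div_cancel_right₀ _ hd] at h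
  · obtain ⟨h1, h2⟩ := morganVoyce_of_five_add_three hp5 (by omega) hxy
    refine ⟨fun h3 ↦ hS.ratModEq (by rwa [h1 h3]), fun h3 ↦ hS.ratModEq ?_⟩
    have hy := not_dvd_right hp (not_intCast_dvd_of_lt (by norm_num) (by omega)) hxy
    have hd : ((2 * y : ℤ) : ZMod p) ≠ 0 := by
      rw [Ne, ZMod.intCast_zmod_eq_zero_iff_dvd]
      intro h
      exact hy ((hpZ.dvd_or_dvd h).resolve_left (not_intCast_dvd_of_lt (by norm_num) (by omega)))
    have h := (ReducesTo.intCast (p := p) (-(x + y))).div_intCast hd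
    push_cast at h hd
    rwa [← h2 h3, mul_div_cancel_right₀ _ hd] at h
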